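/- **Setting.** For every $d$ let a latent variable model with latent space $\mathbb R^d$ be given at a fixed observation $x$: open sets $\Theta\subseteq\mathbb R^{a}$, $\Phi\subseteq\mathbb R^{b}$, a $\sigma$-finite measure $\nu$ on $\mathbb R^d$, a nonnegative joint density $p_\theta(x,z)$ with $p_\theta(x)=\int p_\theta(x,z)\,\nu(dz)<\infty$ and $p_\theta(z|x)=p_\theta(x,z)/p_\theta(x)$, and variational probability densities $q_\phi(z|x)$, such that $p_\theta(z|x)>0$ and $q_\phi(z|x)>0$ for $\nu$-a.e. $z$, and such that $\theta\mapsto p_\theta(x)$, $(z,\theta)\mapsto p_\theta(z|x)$ and $(z,\phi)\mapsto q_\phi(z|x)$ are differentiable on $\Theta$, $\mathbb R^d\times\Theta$ and $\mathbb R^d\times\Phi$. Assume a reparameterization: a random variable $\varepsilon\sim q$ and a function $f$ with $f(\varepsilon,\phi;x)\sim q_\phi(\cdot|x)$ for all $\phi\in\Phi$ and, almost surely, $\phi\mapsto f(\varepsilon,\phi;x)$ differentiable on $\Phi$. All these objects (including $x$, $a$, $b$ and the parameters below) may depend on $d$. Put $$w_{\theta,\phi}(z;x)=\frac{p_\theta(x,z)}{q_\phi(z|x)},\qquad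 \tilde w_{\theta,\phi,\phi'}(\varepsilon)=w_{\theta,\phi}(f(\varepsilon,\phi';x);x),\qquad B_d(\theta,\phi,\phi';x)=\sqrt{\mathrm{Var}(\log\tilde w_{\theta,\phi,\phi'}(\varepsilon))}.$$ Let $\alpha\in[0,1)$, let $(\theta,\phi)\in\Theta\times\Phi$, and let $\psi$ be a component of $\phi=(\phi_1,\dots,\phi_b)$; $\psi'$ denotes the same component of $\phi'$. For $\varepsilon_1,\dots,\varepsilon_N$ i.i.d. copies of $\varepsilon$, the doubly-reparameterized gradient estimator is $$\mathrm{DREP}_{1,N,d}=\sum_{j=1}^N\bigl(\alpha W_j+(1-\alpha)W_j^2\bigr)\,\partial_{\psi'}\log\tilde w_{\theta,\phi,\phi'}(\varepsilon_j)\big|_{\phi'=\phi},\qquad W_j=\frac{\tilde w_{\theta,\phi,\phi}(\varepsilon_j)^{1-\alpha}}{\sum_{l=1}^N\tilde w_{\theta,\phi,\phi}(\varepsilon_l)^{1-\alpha}},$$ and $\mathrm{SNR}[X]=|\mathbb E(X)|/\sqrt{\mathrm{Var}(X)}$. **Assumptions.** For every $d$: (a) $(\log\tilde w_{\theta,\phi,\phi'}(\varepsilon))_{(\theta,\phi,\phi')\in\Theta\times\Phi^2}$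 is a Gaussian random field; (b) every $(\theta,\phi)\in\Theta\times\Phi$ admits a set $\mathcal V\subseteq\Theta\times\Phi$, containing, for some $\rho>0$, all points obtained from $(\theta,\phi)$ by replacing $\psi$ by a number in $(\psi-\rho,\psi+\rho)$, such that $$\mathbb E\Bigl(\sup_{\phi':(\theta,\phi')\in\mathcal V}\bigl(\partial_{\psi'}\log\tilde w_{\theta,\phi,\phi'}(\varepsilon)\bigr)^2\Bigr)<\infty,\qquad \mathbb E\Bigl(\sup_{\phi':(\theta,\phi')\in\mathcal V}\bigl(\log\tilde w_{\theta,\phi,\phi'}(\varepsilon)\bigr)^2\Bigr)<\infty .$$ Write $B_d=B_d(\theta,\phi,\phi;x)$ and let $N,d\to\infty$ in such a way that, for some $r>0$, $\sqrt{\log N}\ll B_d\ll N^r$. **Theorem 5.** Under these assumptions, as $N,d\to\infty$: (i) If $\mathrm{Var}(\mathrm{DREP}_{1,1,d})>0$ eventually, $$\mathrm{SNR}\Bigl[\mathrm{DREP}_{1,1,d}-\partial_{\psi'}\log\mathbb E\bigl(\tilde w_{\theta,\phi,\phi'}(\varepsilon)\bigr)\big|_{\phi'=\phi}\Bigr]\,\frac{\sqrt{\log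 N}}{B_d}=o(1)\quad\text{and}\quad \mathrm{SNR}[\mathrm{DREP}_{1,1,d}]\Bigl(\frac{\sqrt{\log N}}{B_d}\Bigr)^{1/2}=o(1),$$ then, eventually, $\mathrm{DREP}_{1,N,d}$ is square integrable with positive variance, and $$\mathrm{SNR}[\mathrm{DREP}_{1,N,d}]=\mathrm{SNR}[\mathrm{DREP}_{1,1,d}]\,(1+o(1))+o(1).$$ (ii) If $\mathrm{Var}(\mathrm{DREP}_{1,1,d})=0$ eventually (in particular, if it vanishes for all large $d$), then, eventually, $\mathrm{DREP}_{1,N,d}$ is square integrable, and $$\mathbb E(\mathrm{DREP}_{1,N,d})=\mathbb E(\mathrm{DREP}_{1,1,d})\,(1+o(1)),\qquad \mathrm{Var}(\mathrm{DREP}_{1,N,d})=\bigl(\mathbb E(\mathrm{DREP}_{1,1,d})\bigr)^2\,O\Bigl(\frac{\sqrt{\log N}}{B_d}\Bigr).$$ -/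

import Mathlib

open MeasureTheory ProbabilityTheory Filter Topology Asymptotics

noncomputable section

/-- The data of a latent variable model with latent space `ℝ^d`, at a fixed observation `x` (which
is left implicit, as all densities are taken at this observation), together with a variational
family and a reparameterization. The noise `ε` takes its values in an arbitrary measurable
space `E`. -/
structure LatentModel (E : Type*) [MeasurableSpace E] (d : ℕ) where
  /-- dimension of the model parameter `θ` -/
  a : ℕ
  /-- dimension of the variational parameter `φ` -/
  b : ℕ
  /-- parameter set of `θ` -/
  Θ : Set (Fin a → ℝ)
  /-- parameter set of `φ` -/
  Φ : Set (Fin b → ℝ)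
  /-- dominating measure on the latent space -/
  ν : Measure (Fin d → ℝ)
  /-- `joint θ z` is `p_θ(x, z)` -/
  joint : (Fin a → ℝ) → (Fin d → ℝ) → ℝ
  /-- `q φ z` is `q_φ(z | x)` -/
  q : (Fin b → ℝ) → (Fin d → ℝ) → ℝ
  /-- the law of the noise `ε` -/
  noise : Measure E
  /-- the reparameterization `f(ε, φ; x)` -/
  f : E → (Fin b → ℝ) → (Fin d → ℝ)

namespace LatentModel

variable {E : Type*} [MeasurableSpace E] {d : ℕ} (𝓜 : LatentModel E d)

/-- The marginal likelihood `p_θ(x) = ∫ p_θ(x, z) ν(dz)`. -/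
def evidence (θ : Fin 𝓜.a → ℝ) : ℝ := ∫ z, 𝓜.joint θ z ∂𝓜.ν

/-- The posterior density `p_θ(z | x) = p_θ(x, z) / p_θ(x)`. -/
def posterior (θ : Fin 𝓜.a → ℝ) (z : Fin d → ℝ) : ℝ := 𝓜.joint θ z / 𝓜.evidence θ

/-- The standing assumptions on the model, the variational family and the reparameterization. -/
structure Standing : Prop where
  isOpen_Θ : IsOpen 𝓜.Θ
  isOpen_Φ : IsOpen 𝓜.Φ
  sigmaFinite_ν : SigmaFinite 𝓜.ν
  joint_nonneg : ∀ θ ∈ 𝓜.Θ, ∀ z, 0 ≤ 𝓜.joint θ z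
  q_nonneg : ∀ φ ∈ 𝓜.Φ, ∀ z, 0 ≤ 𝓜.q φ z
  integrable_joint : ∀ θ ∈ 𝓜.Θ, Integrable (𝓜.joint θ) 𝓜.ν
  integrable_q : ∀ φ ∈ 𝓜.Φ, Integrable (𝓜.q φ) 𝓜.ν
  integral_q : ∀ φ ∈ 𝓜.Φ, ∫ z, 𝓜.q φ z ∂𝓜.ν = 1
  posterior_pos : ∀ θ ∈ 𝓜.Θ, ∀ᵐ z ∂𝓜.ν, 0 < 𝓜.posterior θ z
  q_pos : ∀ φ ∈ 𝓜.Φ, ∀ᵐ z ∂𝓜.ν, 0 < 𝓜.q φ z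
  differentiable_evidence : DifferentiableOn ℝ 𝓜.evidence 𝓜.Θ
  differentiable_posterior : DifferentiableOn ℝ
    (fun y : (Fin d → ℝ) × (Fin 𝓜.a → ℝ) => 𝓜.posterior y.2 y.1) (Set.univ ×ˢ 𝓜.Θ)
  differentiable_q : DifferentiableOn ℝ
    (fun y : (Fin d → ℝ) × (Fin 𝓜.b → ℝ) => 𝓜.q y.2 y.1) (Set.univ ×ˢ 𝓜.Φ)
  isProbabilityMeasure_noise : IsProbabilityMeasure 𝓜.noise
  /-- `f(ε, φ; x) ∼ q_φ(· | x)` when `ε` follows the law of the noise -/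
  hasLaw_f : ∀ φ ∈ 𝓜.Φ,
    HasLaw (fun ε => 𝓜.f ε φ) (𝓜.ν.withDensity fun z => ENNReal.ofReal (𝓜.q φ z)) 𝓜.noise
  differentiable_f : ∀ᵐ ε ∂𝓜.noise, DifferentiableOn ℝ (𝓜.f ε) 𝓜.Φ

/-- The importance weight `w_{θ,φ}(z; x) = p_θ(x, z) / q_φ(z | x)`. -/
def weight (θ : Fin 𝓜.a → ℝ) (φ : Fin 𝓜.b → ℝ) (z : Fin d → ℝ) : ℝ :=
  𝓜.joint θ z / 𝓜.q φ z

/-- The reparameterized weight `w_{θ,φ}(f(ε, φ'; x); x)`. -/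
def tw (θ : Fin 𝓜.a → ℝ) (φ φ' : Fin 𝓜.b → ℝ) (ε : E) : ℝ :=
  𝓜.weight θ φ (𝓜.f ε φ')

/-- The log-weight `log w_{θ,φ}(f(ε, φ'; x); x)`. -/
def logW (θ : Fin 𝓜.a → ℝ) (φ φ' : Fin 𝓜.b → ℝ) (ε : E) : ℝ :=
  Real.log (𝓜.tw θ φ φ' ε)

/-- The partial derivative of `φ' ↦ log w_{θ,φ}(f(ε, φ'; x); x)` in the `k`-th component of `φ'`,
at the point `φ'`; the first variational parameter `φ` is held fixed. -/
def dlogW (k : Fin 𝓜.b) (θ : Fin 𝓜.a → ℝ) (φ φ' : Fin 𝓜.b → ℝ) (ε : E) : ℝ :=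
  deriv (fun t => 𝓜.logW θ φ (Function.update φ' k t) ε) (φ' k)

/-- The partial derivative of `φ' ↦ log 𝔼 w_{θ,φ}(f(ε, φ'; x); x)` in the `k`-th component of
`φ'`, at `φ' = φ`. -/
def dlogMeanW (k : Fin 𝓜.b) (θ : Fin 𝓜.a → ℝ) (φ : Fin 𝓜.b → ℝ) : ℝ :=
  deriv (fun t => Real.log (∫ ε, 𝓜.tw θ φ (Function.update φ k t) ε ∂𝓜.noise)) (φ k)

/-- `B_d(θ, φ, φ'; x)`, the standard deviation of the log-weight. -/
def B (θ : Fin 𝓜.a → ℝ) (φ φ' : Fin 𝓜.b → ℝ) : ℝ :=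
  √(Var[𝓜.logW θ φ φ'; 𝓜.noise])

/-- The log-weights form a Gaussian random field indexed by `(θ, φ, φ') ∈ Θ × Φ × Φ`. -/
def GaussianField : Prop :=
  IsGaussianProcess (fun (s : 𝓜.Θ × 𝓜.Φ × 𝓜.Φ) (ε : E) => 𝓜.logW s.1 s.2.1 s.2.2 ε) 𝓜.noise

/-- `V` is a neighborhood of `(θ, φ)` in the direction of the `k`-th component of `φ`. -/
def IsCompNhd (k : Fin 𝓜.b) (θ : Fin 𝓜.a → ℝ) (φ : Fin 𝓜.b → ℝ)
    (V : Set ((Fin 𝓜.a → ℝ) × (Fin 𝓜.b → ℝ))) : Prop :=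
  ∃ r : ℝ, 0 < r ∧ ∀ t ∈ Set.Ioo (φ k - r) (φ k + r), (θ, Function.update φ k t) ∈ V

/-- The domination condition for the doubly-reparameterized gradient with respect to the `k`-th
component of `φ`: locally uniform second moments of the log-weight and of its partial derivative. -/
def Dominated (k : Fin 𝓜.b) : Prop :=
  ∀ θ ∈ 𝓜.Θ, ∀ φ ∈ 𝓜.Φ, ∃ V ⊆ 𝓜.Θ ×ˢ 𝓜.Φ, 𝓜.IsCompNhd k θ φ V ∧
    ∫⁻ ε, (⨆ φ' : Fin 𝓜.b → ℝ, ⨆ _ : (θ, φ') ∈ V,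
      ENNReal.ofReal (𝓜.dlogW k θ φ φ' ε ^ 2)) ∂𝓜.noise < ⊤ ∧
    ∫⁻ ε, (⨆ φ' : Fin 𝓜.b → ℝ, ⨆ _ : (θ, φ') ∈ V,
      ENNReal.ofReal (𝓜.logW θ φ φ' ε ^ 2)) ∂𝓜.noise < ⊤

/-- The self-normalized weight
`w(Z_j; x)^(1-α) / ∑_l w(Z_l; x)^(1-α)` with `Z_l = f(ε_l, φ; x)`. -/
def normWeight (α : ℝ) (θ : Fin 𝓜.a → ℝ) (φ : Fin 𝓜.b → ℝ) {N : ℕ} (ε : Fin N → E)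
    (j : Fin N) : ℝ :=
  𝓜.weight θ φ (𝓜.f (ε j) φ) ^ (1 - α) / ∑ l, 𝓜.weight θ φ (𝓜.f (ε l) φ) ^ (1 - α)

/-- The doubly-reparameterized gradient estimator `DREP_{1,N,d}` with respect to the `k`-th
component of `φ` (one batch of `N` noise samples `ε_1, …, ε_N`). -/
def drep (α : ℝ) (k : Fin 𝓜.b) (θ : Fin 𝓜.a → ℝ) (φ : Fin 𝓜.b → ℝ) (N : ℕ)
    (ε : Fin N → E) : ℝ :=
  ∑ j, (α * 𝓜.normWeight α θ φ ε j + (1 - α) * 𝓜.normWeight α θ φ ε j ^ 2) *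
    𝓜.dlogW k θ φ φ (ε j)

/-- The joint law of `N` independent copies of the noise. -/
def sampleLaw (N : ℕ) : Measure (Fin N → E) := Measure.pi fun _ => 𝓜.noise

end LatentModel

/-- The signal-to-noise ratio `|𝔼 X| / √(Var X)`; it is meaningful when `X` is square integrable
with positive variance. -/
def SNR {Ω : Type*} [MeasurableSpace Ω] (X : Ω → ℝ) (μ : Measure Ω) : ℝ :=
  |∫ ω, X ω ∂μ| / √(Var[X; μ])

end

/-! Write X for the log-weight and D for its partial derivative at one noise sample, μ and s for the
mean and variance of D, B for the standard deviation of X, and c = cov(X, D)/B. As an almost sure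
limit of difference quotients of a Gaussian field, D is jointly Gaussian with X
(`hasGaussianLaw_deriv`). Regression then gives D = μ + c S + R, where S is the standardized X and R
is centred, independent of S, with variance s - c². The normalized weights W_j are softmax weights
of the S_j at inverse temperature β = (1 - α) B, so the estimator is ∑ a_j (μ + c S_j + R_j) with
W_j² ≤ a_j ≤ W_j.

The crux is that the softmax concentrates on one sample. Stein's identity gives β E ∑ W_j (1 - W_j)
= E ∑ S_j W_j, while the softmax average of S_j² has expectation O(log N) whatever β is. Hence E ∑
W_j (1 - W_j) = O(η) with η = √(log N)/B (`integral_softmax_mul_one_sub_le`). It follows that the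
mean is μ (1 - O(η)) + c O(√(log N)) and the variance is (s - c²)(1 - O(η)) + O(μ² η + c² log N)
(`drepStd_estimates`).

Since log E exp X = E X + Var X / 2 for Gaussian X, its derivative is μ + cov(X, D), so the bias in
(i) is -cov(X, D). The two smallness hypotheses of (i) therefore say that c √(log N) and μ √η are
o(√s), which is what `snr_asymptotics` needs. In (ii) D is almost surely constant, so s = c = 0 and
only the μ terms remain. -/

noncomputable section

/-! ### Gaussian integration by parts. -/

section Stein

/-- **Stein's identity**: Gaussian integration by parts on the line. -/
lemma integral_id_mul_gaussianReal {h h' : ℝ → ℝ} {C : ℝ} (hd : ∀ x, HasDerivAt h (h' x) x)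
    (hC : ∀ x, |h x| ≤ C) (hC' : ∀ x, |h' x| ≤ C) :
    ∫ x, x * h x ∂(gaussianReal 0 1) = ∫ x, h' x ∂(gaussianReal 0 1) := by
  have hp : ∀ x, HasDerivAt (gaussianPDFReal 0 1) (-x * gaussianPDFReal 0 1 x) x := by
    intro x
    have h1 : HasDerivAt (fun x : ℝ => (√(2 * Real.pi * (1 : NNReal)))⁻¹ *
        Real.exp (-(x - 0) ^ 2 / (2 * (1 : NNReal)))) _ x :=
      (((((hasDerivAt_id x).sub_const 0).pow 2).neg.div_const _).exp).const_mul _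
    rw [gaussianPDFReal_def]
    exact h1.congr_deriv (by simp; ring)
  have hmeas : Measurable h := (continuous_iff_continuousAt.2 fun x => (hd x).continuousAt).measurable
  have hmeas' : Measurable h' := by
    have : h' = deriv h := funext fun x => (hd x).deriv.symm
    rw [this]; exact measurable_deriv h
  have hid : Integrable (fun x => x * gaussianPDFReal 0 1 x) := by
    have := (memLp_id_gaussianReal' (μ := 0) (v := 1) 1 (by simp)).integrable le_rfl
    rw [gaussianReal_of_var_ne_zero _ one_ne_zero, integrable_withDensity_iff
      (measurable_gaussianPDF 0 1) (ae_of_all _ fun x => gaussianPDF_lt_top)] at this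
    simpa using this
  have key := integral_mul_deriv_eq_deriv_mul_of_integrable (u := h) (u' := h')
    (v := gaussianPDFReal 0 1) (v' := fun x => -x * gaussianPDFReal 0 1 x)
    (fun x _ => hd x) (fun x _ => hp x) ?_ ?_ ?_
  · rw [integral_gaussianReal_eq_integral_smul one_ne_zero,
      integral_gaussianReal_eq_integral_smul one_ne_zero]
    simp only [smul_eq_mul]
    have e1 : ∫ x, h x * (-x * gaussianPDFReal 0 1 x) = - ∫ x, gaussianPDFReal 0 1 x * (x * h x) := by
      rw [← integral_neg]; congr 1; ext x; ring
    rw [e1, neg_inj] at key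
    rw [key]; congr 1; ext x; ring
  · have : h * (fun x => -x * gaussianPDFReal 0 1 x) =
        fun x => h x * -(x * gaussianPDFReal 0 1 x) := by ext x; simp
    rw [this]
    exact hid.neg.bdd_mul hmeas.aestronglyMeasurable (ae_of_all _ hC)
  · exact (integrable_gaussianPDFReal 0 1).bdd_mul hmeas'.aestronglyMeasurable (ae_of_all _ hC')
  · exact (integrable_gaussianPDFReal 0 1).bdd_mul hmeas.aestronglyMeasurable (ae_of_all _ hC)

/-- The standard Gaussian measure on `ℝ^N`. -/
abbrev stdGaussianPi (N : ℕ) : Measure (Fin N → ℝ) := Measure.pi fun _ => gaussianReal 0 1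

/-- Stein's identity in one coordinate of a standard Gaussian vector. -/
lemma integral_eval_mul_stdGaussianPi {n : ℕ} (j : Fin (n + 1)) {F F' : (Fin (n + 1) → ℝ) → ℝ}
    {C : ℝ} (hF : Measurable F) (hF' : Measurable F')
    (hd : ∀ t y, HasDerivAt (fun t => F (j.insertNth t y)) (F' (j.insertNth t y)) t)
    (hC : ∀ x, |F x| ≤ C) (hC' : ∀ x, |F' x| ≤ C) :
    ∫ s, s j * F s ∂(stdGaussianPi (n + 1)) = ∫ s, F' s ∂(stdGaussianPi (n + 1)) := by
  have mp := (measurePreserving_piFinSuccAbove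
    (fun _ : Fin (n + 1) => gaussianReal 0 1) j).symm
  have hj : Integrable (fun s : Fin (n + 1) → ℝ => s j) (stdGaussianPi (n + 1)) :=
    (measurePreserving_eval (fun _ : Fin (n + 1) => gaussianReal 0 1) j).integrable_comp_of_integrable
      ((memLp_id_gaussianReal' (μ := 0) (v := 1) 1 (by simp)).integrable le_rfl)
  have i1 : Integrable (fun s => s j * F s) (stdGaussianPi (n + 1)) :=
    hj.mul_bdd hF.aestronglyMeasurable (ae_of_all _ hC)
  have i2 : Integrable F' (stdGaussianPi (n + 1)) :=
    .of_bound hF'.aestronglyMeasurable C (ae_of_all _ hC')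
  rw [← mp.integral_comp (MeasurableEquiv.measurableEmbedding _),
    ← mp.integral_comp (MeasurableEquiv.measurableEmbedding _), integral_prod_symm,
    integral_prod_symm]
  · congr 1
    ext y
    have := integral_id_mul_gaussianReal (h := fun t => F (j.insertNth t y))
      (h' := fun t => F' (j.insertNth t y)) (C := C) (fun t => hd t y) (fun t => hC _)
      (fun t => hC' _)
    have e : ∀ x, (MeasurableEquiv.piFinSuccAbove (fun _ : Fin (n + 1) => ℝ) j).symm (x, y) =
        j.insertNth x y := fun _ => rfl
    simpa [e] using this
  · exact mp.integrable_comp_of_integrable i2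
  · exact mp.integrable_comp_of_integrable i1

end Stein

/-! ### Concentration of the softmax of a Gaussian vector. -/

section Softmax

/-- The softmax weights `exp (β s_j) / ∑_l exp (β s_l)`. -/
def softmax {N : ℕ} (β : ℝ) (j : Fin N) (s : Fin N → ℝ) : ℝ :=
  Real.exp (β * s j) / ∑ l, Real.exp (β * s l)

variable {N : ℕ} {β : ℝ}

lemma softmax_nonneg (j : Fin N) (s : Fin N → ℝ) : 0 ≤ softmax β j s := by
  unfold softmax; positivity

lemma sum_softmax (hN : 0 < N) (s : Fin N → ℝ) : ∑ j, softmax β j s = 1 := by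
  have : Nonempty (Fin N) := ⟨⟨0, hN⟩⟩
  unfold softmax
  rw [← Finset.sum_div]
  exact div_self (Finset.sum_pos (fun _ _ => Real.exp_pos _) Finset.univ_nonempty).ne'

lemma softmax_le_one (j : Fin N) (s : Fin N → ℝ) : softmax β j s ≤ 1 := by
  rw [← sum_softmax (β := β) j.pos s]
  exact Finset.single_le_sum (fun i _ => softmax_nonneg i s) (Finset.mem_univ j)

@[fun_prop]
lemma measurable_softmax (j : Fin N) : Measurable (softmax β j) := by
  unfold softmax; fun_prop

/-- With the other coordinates frozen, the softmax is a logistic function of `β * t`; this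
derivative is what Stein's identity turns into the concentration quantity. -/
lemma hasDerivAt_softmax_insertNth {n : ℕ} (j : Fin (n + 1)) (t : ℝ) (y : Fin n → ℝ) :
    HasDerivAt (fun t => softmax β j (j.insertNth t y))
      (β * (softmax β j (j.insertNth t y) * (1 - softmax β j (j.insertNth t y)))) t := by
  have e : ∀ t, softmax β j (j.insertNth t y) =
      Real.exp (β * t) / (Real.exp (β * t) + ∑ i, Real.exp (β * y i)) := by
    intro t
    unfold softmax
    rw [Fin.sum_univ_succAbove _ j]
    simp
  have hpos : 0 < Real.exp (β * t) + ∑ i, Real.exp (β * y i) := by positivity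
  have h1 : HasDerivAt (fun t => Real.exp (β * t)) (Real.exp (β * t) * (β * 1)) t :=
    ((hasDerivAt_id t).const_mul β).exp
  simp only [e]
  refine (h1.div (h1.add_const _) hpos.ne').congr_deriv ?_
  field_simp

lemma integrable_eval_stdGaussianPi (j : Fin N) :
    Integrable (fun s : Fin N → ℝ => s j) (stdGaussianPi N) :=
  (measurePreserving_eval (fun _ : Fin N => gaussianReal 0 1) j).integrable_comp_of_integrable
    ((memLp_id_gaussianReal' (μ := 0) (v := 1) 1 (by simp)).integrable le_rfl)

lemma integrable_eval_sq_stdGaussianPi (j : Fin N) :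
    Integrable (fun s : Fin N → ℝ => s j ^ 2) (stdGaussianPi N) :=
  (measurePreserving_eval (fun _ : Fin N => gaussianReal 0 1) j).integrable_comp_of_integrable
    (g := fun x : ℝ => x ^ 2) (memLp_id_gaussianReal' (μ := 0) (v := 1) 2 (by simp)).integrable_sq

lemma integrable_softmax_mul_sq :
    Integrable (fun s => ∑ j, softmax β j s * s j ^ 2) (stdGaussianPi N) :=
  integrable_finsetSum _ fun j _ => (integrable_eval_sq_stdGaussianPi j).bdd_mul (c := 1)
    (by fun_prop) (ae_of_all _ fun s => by
      rw [Real.norm_of_nonneg (softmax_nonneg _ _)]; exact softmax_le_one _ _)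

/-- The softmax average of the squared coordinates of a standard Gaussian vector is of order
`log N`, uniformly in `β`. -/
lemma exists_integral_softmax_mul_sq_le :
    ∃ K : ℝ, 0 < K ∧ ∀ (N : ℕ) (β : ℝ), 3 ≤ N →
      ∫ s, ∑ j, softmax β j s * s j ^ 2 ∂(stdGaussianPi N) ≤ K * Real.log N := by
  -- Fernique's theorem: some exponential moment of the square is finite.
  obtain ⟨C, hC, hint⟩ := IsGaussian.exists_integrable_exp_sq (gaussianReal 0 1)
  simp only [Real.norm_eq_abs, sq_abs] at hint
  set M := ∫ x, Real.exp (C * x ^ 2) ∂(gaussianReal 0 1) with hM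
  have hM0 : 0 ≤ M := integral_nonneg fun x => (Real.exp_pos _).le
  refine ⟨(1 + M) / C, by positivity, fun N β hN => ?_⟩
  have hN0 : (0 : ℝ) < N := by positivity
  -- This is where `3 ≤ N` enters: the constant `M` is absorbed into `M * log N` at the end.
  have hlog : 1 ≤ Real.log N := by
    rw [Real.le_log_iff_exp_le hN0]
    have : (3 : ℝ) ≤ N := by exact_mod_cast hN
    linarith [Real.exp_one_lt_d9]
  have hei : ∀ j : Fin N, Integrable (fun s : Fin N → ℝ => Real.exp (C * s j ^ 2))
      (stdGaussianPi N) := fun j =>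
    (measurePreserving_eval (fun _ : Fin N => gaussianReal 0 1) j).integrable_comp_of_integrable
      (g := fun x : ℝ => Real.exp (C * x ^ 2)) hint
  have hpt : ∀ s : Fin N → ℝ, ∑ j, softmax β j s * s j ^ 2 ≤
      (Real.log N + (N : ℝ)⁻¹ * ∑ j, Real.exp (C * s j ^ 2)) / C := by
    intro s
    rw [le_div_iff₀ hC, Finset.sum_mul]
    calc ∑ j, softmax β j s * s j ^ 2 * C
        ≤ ∑ j, (softmax β j s * Real.log N + (N : ℝ)⁻¹ * Real.exp (C * s j ^ 2)) := by
          refine Finset.sum_le_sum fun j _ => ?_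
          -- From y + 1 ≤ exp y at y = C s_j² - log N. The softmax weights average the log N term,
          -- and are bounded by 1 in the exponential term, whose factor 1/N compensates the N
          -- summands.
          have h1 : C * s j ^ 2 ≤ Real.log N + (N : ℝ)⁻¹ * Real.exp (C * s j ^ 2) := by
            have := Real.add_one_le_exp (C * s j ^ 2 - Real.log N)
            rw [Real.exp_sub, Real.exp_log hN0, div_eq_inv_mul] at this
            linarith
          have h2 := mul_le_mul_of_nonneg_left h1 (softmax_nonneg (β := β) j s)
          have h3 : softmax β j s * ((N : ℝ)⁻¹ * Real.exp (C * s j ^ 2)) ≤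
              1 * ((N : ℝ)⁻¹ * Real.exp (C * s j ^ 2)) :=
            mul_le_mul_of_nonneg_right (softmax_le_one j s) (by positivity)
          linarith
      _ = _ := by
          rw [Finset.sum_add_distrib, ← Finset.sum_mul, sum_softmax (by omega), one_mul,
            Finset.mul_sum]
  calc ∫ s, ∑ j, softmax β j s * s j ^ 2 ∂(stdGaussianPi N)
      ≤ ∫ s, (Real.log N + (N : ℝ)⁻¹ * ∑ j, Real.exp (C * s j ^ 2)) / C ∂(stdGaussianPi N) :=
        integral_mono integrable_softmax_mul_sq
          (((integrable_const _).add ((integrable_finsetSum _ fun j _ => hei j).const_mul _)).div_const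
            _) hpt
    _ = (Real.log N + M) / C := by
        rw [integral_div, integral_add (integrable_const _)
          ((integrable_finsetSum _ fun j _ => hei j).const_mul _), integral_const_mul,
          integral_finsetSum _ fun j _ => hei j]
        have : ∀ j : Fin N, ∫ s : Fin N → ℝ, Real.exp (C * s j ^ 2) ∂(stdGaussianPi N) = M :=
          fun j => integral_comp_eval (μ := fun _ : Fin N => gaussianReal 0 1) (i := j)
            (f := fun x => Real.exp (C * x ^ 2)) hint.aestronglyMeasurable
        simp only [this]
        simp [hN0.ne']
    _ ≤ (1 + M) / C * Real.log N := by
        rw [div_mul_eq_mul_div, div_le_div_iff_of_pos_right hC]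
        nlinarith

/-- Jensen's inequality for the softmax probabilities. Allowing smaller coefficients `b` covers both
the softmax weights and the estimator's coefficients. -/
lemma sq_sum_softmax_mul_le (hN : 0 < N) {b : Fin N → ℝ} {s : Fin N → ℝ}
    (hb0 : ∀ j, 0 ≤ b j) (hb : ∀ j, b j ≤ softmax β j s) :
    (∑ j, b j * s j) ^ 2 ≤ ∑ j, softmax β j s * s j ^ 2 := by
  have h1 : |∑ j, b j * s j| ≤ ∑ j, softmax β j s * |s j| := by
    refine (Finset.abs_sum_le_sum_abs _ _).trans (Finset.sum_le_sum fun j _ => ?_)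
    rw [abs_mul, abs_of_nonneg (hb0 j)]
    exact mul_le_mul_of_nonneg_right (hb j) (abs_nonneg _)
  have h2 := Real.pow_arith_mean_le_arith_mean_pow Finset.univ (fun j => softmax β j s)
    (fun j => |s j|) (fun j _ => softmax_nonneg j s) (sum_softmax hN s) (fun j _ => abs_nonneg _) 2
  calc (∑ j, b j * s j) ^ 2 = |∑ j, b j * s j| ^ 2 := (sq_abs _).symm
    _ ≤ (∑ j, softmax β j s * |s j|) ^ 2 := by gcongr
    _ ≤ _ := by simpa using h2

/-- A softmax of a standard Gaussian vector at a large inverse temperature `β` concentrates on a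
single coordinate. -/
lemma integral_softmax_mul_one_sub_le {K : ℝ} (hβ : 0 < β) (hN : 0 < N) (hK : 0 < K)
    (h : ∫ s, ∑ j, softmax β j s * s j ^ 2 ∂(stdGaussianPi N) ≤ K ^ 2) :
    ∫ s, ∑ j, softmax β j s * (1 - softmax β j s) ∂(stdGaussianPi N) ≤ K / β := by
  have hb : ∀ (j : Fin N) s, |softmax β j s| ≤ 1 := fun j s => by
    rw [abs_of_nonneg (softmax_nonneg _ _)]; exact softmax_le_one _ _
  have hb' : ∀ (j : Fin N) s, |softmax β j s * (1 - softmax β j s)| ≤ 1 := fun j s => by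
    have h0 := softmax_nonneg (β := β) j s
    have h1 := softmax_le_one (β := β) j s
    rw [abs_of_nonneg (mul_nonneg h0 (by linarith))]
    nlinarith
  have hi : ∀ j : Fin N, Integrable (fun s => softmax β j s * (1 - softmax β j s))
      (stdGaussianPi N) := fun j => .of_bound (by fun_prop) 1 (ae_of_all _ (hb' j))
  have hi2 : ∀ j : Fin N, Integrable (fun s => s j * softmax β j s) (stdGaussianPi N) := fun j =>
    (integrable_eval_stdGaussianPi j).mul_bdd (c := 1) (by fun_prop) (ae_of_all _ (hb j))
  have stein : ∀ j : Fin N, ∫ s, s j * softmax β j s ∂(stdGaussianPi N) =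
      β * ∫ s, softmax β j s * (1 - softmax β j s) ∂(stdGaussianPi N) := by
    intro j
    obtain ⟨n, rfl⟩ : ∃ n, N = n + 1 := ⟨N - 1, by omega⟩
    rw [← integral_const_mul]
    -- A single constant has to bound both the softmax and its derivative, which carries a factor β.
    refine integral_eval_mul_stdGaussianPi (C := max 1 |β|) j (by fun_prop) (by fun_prop)
      (fun t y => hasDerivAt_softmax_insertNth j t y) (fun s => (hb j s).trans (le_max_left _ _))
      fun s => ?_
    rw [abs_mul]
    exact (mul_le_of_le_one_right (abs_nonneg _) (hb' j s)).trans (le_max_right _ _)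
  rw [le_div_iff₀' hβ, integral_finsetSum _ fun j _ => hi j, Finset.mul_sum]
  simp only [← stein]
  rw [← integral_finsetSum _ fun j _ => hi2 j]
  -- The pointwise bound x ≤ K/2 + x²/(2K) plays the role of Cauchy–Schwarz.
  calc ∫ s, ∑ j, s j * softmax β j s ∂(stdGaussianPi N)
      ≤ ∫ s, (K / 2 + (∑ j, softmax β j s * s j ^ 2) / (2 * K)) ∂(stdGaussianPi N) := by
        refine integral_mono (integrable_finsetSum _ fun j _ => hi2 j)
          ((integrable_const _).add (integrable_softmax_mul_sq.div_const _)) fun s => ?_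
        have h1 := sq_sum_softmax_mul_le (β := β) hN (s := s) (fun j => softmax_nonneg j s)
          (fun j => le_rfl)
        have h2 : ∑ j, s j * softmax β j s = ∑ j, softmax β j s * s j := by simp only [mul_comm]
        simp only [h2]
        rw [div_add_div _ _ two_ne_zero (by positivity), le_div_iff₀ (by positivity)]
        nlinarith [sq_nonneg (∑ j, softmax β j s * s j - K)]
    _ = K / 2 + (∫ s, ∑ j, softmax β j s * s j ^ 2 ∂(stdGaussianPi N)) / (2 * K) := by
        rw [integral_add (integrable_const _) (integrable_softmax_mul_sq.div_const _),
          integral_div]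
        simp [integral_div]
    _ ≤ K / 2 + K ^ 2 / (2 * K) := by gcongr
    _ = K := by field_simp; norm_num

end Softmax

/-! ### Mean and variance of the estimator in standardized variables. -/

section Estimator

variable {N : ℕ} {α β : ℝ}

/-- The coefficient `α W_j + (1 - α) W_j²` built from the softmax weight `W_j`. -/
def drepCoeff (α β : ℝ) (j : Fin N) (s : Fin N → ℝ) : ℝ :=
  α * softmax β j s + (1 - α) * softmax β j s ^ 2

@[fun_prop]
lemma measurable_drepCoeff (j : Fin N) : Measurable (drepCoeff α β j) := by
  unfold drepCoeff; fun_prop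

lemma drepCoeff_nonneg (h0 : 0 ≤ α) (h1 : α < 1) (j : Fin N) (s : Fin N → ℝ) :
    0 ≤ drepCoeff α β j s := by
  have := softmax_nonneg (β := β) j s
  have : 0 ≤ 1 - α := by linarith
  unfold drepCoeff; positivity

lemma sq_softmax_le_drepCoeff (h0 : 0 ≤ α) (j : Fin N) (s : Fin N → ℝ) :
    softmax β j s ^ 2 ≤ drepCoeff α β j s := by
  have h1 := softmax_nonneg (β := β) j s
  have h2 := softmax_le_one (β := β) j s
  unfold drepCoeff
  nlinarith [mul_nonneg h0 (mul_nonneg h1 (sub_nonneg.2 h2))]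

lemma drepCoeff_le_softmax (h1 : α < 1) (j : Fin N) (s : Fin N → ℝ) :
    drepCoeff α β j s ≤ softmax β j s := by
  have h2 := softmax_nonneg (β := β) j s
  have h3 := softmax_le_one (β := β) j s
  unfold drepCoeff
  nlinarith [mul_nonneg (sub_nonneg.2 h1.le) (mul_nonneg h2 (sub_nonneg.2 h3))]

lemma abs_drepCoeff_le_one (h0 : 0 ≤ α) (h1 : α < 1) (j : Fin N) (s : Fin N → ℝ) :
    |drepCoeff α β j s| ≤ 1 := by
  rw [abs_of_nonneg (drepCoeff_nonneg h0 h1 j s)]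
  exact (drepCoeff_le_softmax h1 j s).trans (softmax_le_one j s)

lemma sum_drepCoeff_le_one (hN : 0 < N) (h1 : α < 1) (s : Fin N → ℝ) :
    ∑ j, drepCoeff α β j s ≤ 1 := by
  rw [← sum_softmax (β := β) hN s]
  exact Finset.sum_le_sum fun j _ => drepCoeff_le_softmax h1 j s

/-- Softmax weights sum to one, so the deficit is ∑ (W_j - a_j), and a_j ≥ W_j². -/
lemma one_sub_sum_drepCoeff_le (hN : 0 < N) (h0 : 0 ≤ α) (s : Fin N → ℝ) :
    1 - ∑ j, drepCoeff α β j s ≤ ∑ j, softmax β j s * (1 - softmax β j s) := by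
  have e : 1 - ∑ j, drepCoeff α β j s = ∑ j, (softmax β j s - drepCoeff α β j s) := by
    rw [Finset.sum_sub_distrib, sum_softmax hN s]
  rw [e]
  refine Finset.sum_le_sum fun j _ => ?_
  nlinarith [sq_softmax_le_drepCoeff (β := β) h0 j s]

lemma sum_drepCoeff_sq_le_one (hN : 0 < N) (h0 : 0 ≤ α) (h1 : α < 1) (s : Fin N → ℝ) :
    ∑ j, drepCoeff α β j s ^ 2 ≤ 1 := by
  refine le_trans (Finset.sum_le_sum fun j _ => ?_) (sum_drepCoeff_le_one (β := β) hN h1 s)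
  exact pow_le_of_le_one (drepCoeff_nonneg h0 h1 j s)
    ((abs_le.1 (abs_drepCoeff_le_one h0 h1 j s)).2) two_ne_zero

/-- The factor 3 comes from W - a² ≤ W - W⁴ = W (1 - W)(1 + W + W²). -/
lemma one_sub_sum_drepCoeff_sq_le (hN : 0 < N) (h0 : 0 ≤ α) (s : Fin N → ℝ) :
    1 - ∑ j, drepCoeff α β j s ^ 2 ≤ 3 * ∑ j, softmax β j s * (1 - softmax β j s) := by
  have e : 1 - ∑ j, drepCoeff α β j s ^ 2 = ∑ j, (softmax β j s - drepCoeff α β j s ^ 2) := by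
    rw [Finset.sum_sub_distrib, sum_softmax hN s]
  rw [e, Finset.mul_sum]
  refine Finset.sum_le_sum fun j _ => ?_
  have h2 := softmax_nonneg (β := β) j s
  have h3 := softmax_le_one (β := β) j s
  have h4 : (softmax β j s ^ 2) ^ 2 ≤ drepCoeff α β j s ^ 2 :=
    pow_le_pow_left₀ (by positivity) (sq_softmax_le_drepCoeff h0 j s) 2
  have h5 : 0 ≤ softmax β j s * (1 - softmax β j s) := mul_nonneg h2 (by linarith)
  have h6 : softmax β j s ^ 2 ≤ 1 := pow_le_one₀ h2 h3
  nlinarith [mul_nonneg h5 (sub_nonneg.2 h3), mul_nonneg h5 (sub_nonneg.2 h6)]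

/-- The estimator `∑_j a_j(s) (μ + c s_j + r_j)` as a function of the standardized log-weights `s`
and of the independent parts `r` of the gradients. -/
def drepStd (α β μ c : ℝ) (p : (Fin N → ℝ) × (Fin N → ℝ)) : ℝ :=
  ∑ j, drepCoeff α β j p.1 * (μ + c * p.1 j + p.2 j)

lemma memLp_eval_pi {ρ : Measure ℝ} [IsProbabilityMeasure ρ] (hρ : MemLp id 2 ρ) (j : Fin N) :
    MemLp (fun r : Fin N → ℝ => r j) 2 (Measure.pi fun _ => ρ) :=
  hρ.comp_measurePreserving (measurePreserving_eval (fun _ : Fin N => ρ) j)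

/-- The estimator splits as `G + V`: `G = μ * A + c * H` depends on the log-weights alone, and `V`,
linear in the residuals, has conditional mean zero. The two are thus uncorrelated and their
variances add; concentration keeps `A` and the sum of squared coefficients near 1 on average. -/
lemma drepStd_estimates {ρ : Measure ℝ} [IsProbabilityMeasure ρ] (hρ : MemLp id 2 ρ)
    (hρ0 : ∫ x, x ∂ρ = 0) (h0 : 0 ≤ α) (h1 : α < 1) (hβ : 0 < β) (hN : 0 < N) (μ c : ℝ) {L : ℝ}
    (hL : 0 < L) (h : ∫ s, ∑ j, softmax β j s * s j ^ 2 ∂(stdGaussianPi N) ≤ L ^ 2) :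
    MemLp (drepStd (N := N) α β μ c) 2 ((stdGaussianPi N).prod (Measure.pi fun _ => ρ)) ∧
    (∃ e₁ e₂, 0 ≤ e₁ ∧ e₁ ≤ L / β ∧ |e₂| ≤ L ∧
      ∫ p, drepStd (N := N) α β μ c p ∂((stdGaussianPi N).prod (Measure.pi fun _ => ρ)) =
        μ * (1 - e₁) + c * e₂) ∧
    (∃ e₁ e₂, 0 ≤ e₁ ∧ e₁ ≤ 3 * (L / β) ∧ 0 ≤ e₂ ∧
      e₂ ≤ 2 * μ ^ 2 * (L / β) + 2 * c ^ 2 * L ^ 2 ∧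
      Var[drepStd (N := N) α β μ c; (stdGaussianPi N).prod (Measure.pi fun _ => ρ)] =
        Var[id; ρ] * (1 - e₁) + e₂) := by
  set Γ := stdGaussianPi N
  set Ρ : Measure (Fin N → ℝ) := Measure.pi fun _ => ρ
  have hγ : MemLp id 2 (gaussianReal 0 1) := memLp_id_gaussianReal' 2 (by simp)
  have hconc := integral_softmax_mul_one_sub_le hβ hN hL h
  have hmul : ∀ (j : Fin N) s (x : ℝ), ‖drepCoeff α β j s * x‖ ≤ ‖x‖ := fun j s x => by
    rw [norm_mul]
    exact mul_le_of_le_one_left (norm_nonneg _) (abs_drepCoeff_le_one h0 h1 j s)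
  set A : (Fin N → ℝ) → ℝ := fun s => ∑ j, drepCoeff α β j s with hA
  set H : (Fin N → ℝ) → ℝ := fun s => ∑ j, drepCoeff α β j s * s j with hH
  set Q : (Fin N → ℝ) → ℝ := fun s => ∑ j, softmax β j s * (1 - softmax β j s) with hQ
  set V : (Fin N → ℝ) × (Fin N → ℝ) → ℝ := fun p => ∑ j, drepCoeff α β j p.1 * p.2 j with hV
  have hA0 : ∀ s, 0 ≤ A s := fun s => Finset.sum_nonneg fun j _ => drepCoeff_nonneg h0 h1 j s
  have hA1 : ∀ s, A s ≤ 1 := fun s => sum_drepCoeff_le_one hN h1 s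
  have hAQ : ∀ s, 1 - A s ≤ Q s := fun s => one_sub_sum_drepCoeff_le hN h0 s
  have hH2 : ∀ s, H s ^ 2 ≤ ∑ j, softmax β j s * s j ^ 2 := fun s =>
    sq_sum_softmax_mul_le hN (fun j => drepCoeff_nonneg h0 h1 j s)
      (fun j => drepCoeff_le_softmax h1 j s)
  have hAL : MemLp A 2 Γ := MemLp.of_bound (by fun_prop) 1 (ae_of_all _ fun s => by
    rw [Real.norm_of_nonneg (hA0 s)]; exact hA1 s)
  have hHL : MemLp H 2 Γ := memLp_finsetSum _ fun j _ =>
    (memLp_eval_pi hγ j).of_le (by fun_prop) (ae_of_all _ fun s => hmul j s _)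
  have hQI : Integrable Q Γ := by
    refine .of_bound (by fun_prop) (N : ℝ) (ae_of_all _ fun s => ?_)
    have hq : ∀ j, 0 ≤ softmax β j s * (1 - softmax β j s) ∧
        softmax β j s * (1 - softmax β j s) ≤ 1 := fun j => by
      have h2 := softmax_nonneg (β := β) j s
      have h3 := softmax_le_one (β := β) j s
      exact ⟨mul_nonneg h2 (by linarith), by nlinarith⟩
    rw [Real.norm_of_nonneg (Finset.sum_nonneg fun j _ => (hq j).1)]
    simpa using Finset.sum_le_card_nsmul Finset.univ _ 1 fun j _ => (hq j).2
  set G : (Fin N → ℝ) → ℝ := fun s => μ * A s + c * H s with hG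
  have hGL : MemLp G 2 Γ := (hAL.const_mul μ).add (hHL.const_mul c)
  have hVL : MemLp V 2 (Γ.prod Ρ) := memLp_finsetSum _ fun j _ =>
    ((memLp_eval_pi hρ j).comp_measurePreserving measurePreserving_snd).of_le (by fun_prop)
      (ae_of_all _ fun p => hmul j p.1 _)
  have hGL' : MemLp (fun p : (Fin N → ℝ) × (Fin N → ℝ) => G p.1) 2 (Γ.prod Ρ) :=
    hGL.comp_measurePreserving measurePreserving_fst
  have hT : drepStd (N := N) α β μ c = fun p => G p.1 + V p := by
    ext p
    simp only [drepStd, hG, hA, hH, hV, Finset.mul_sum, ← Finset.sum_add_distrib]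
    exact Finset.sum_congr rfl fun j _ => by ring
  have hr0 : ∀ j : Fin N, ∫ r, r j ∂Ρ = 0 := fun j => by
    rw [integral_comp_eval (μ := fun _ : Fin N => ρ) (i := j) (f := fun x => x)
      aestronglyMeasurable_id, hρ0]
  have hVin : ∀ s, ∫ r, V (s, r) ∂Ρ = 0 := fun s => by
    simp only [hV]
    rw [integral_finsetSum _ fun j _ => ((memLp_eval_pi hρ j).integrable one_le_two).const_mul _]
    simp only [integral_const_mul]
    exact Finset.sum_eq_zero fun j _ => by rw [hr0, mul_zero]
  have hV0 : ∫ p, V p ∂(Γ.prod Ρ) = 0 := by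
    rw [integral_prod _ (hVL.integrable one_le_two)]
    simp [hVin]
  have hGV : ∫ p, G p.1 * V p ∂(Γ.prod Ρ) = 0 := by
    rw [integral_prod (fun p => G p.1 * V p) (hGL'.integrable_mul hVL)]
    simp [integral_const_mul, hVin]
  have hEG : ∫ p, G p.1 ∂(Γ.prod Ρ) = ∫ s, G s ∂Γ := by
    rw [integral_fun_fst]; simp
  have hVarG : Var[fun p : (Fin N → ℝ) × (Fin N → ℝ) => G p.1; Γ.prod Ρ] = Var[G; Γ] :=
    (measurePreserving_fst (μ := Γ) (ν := Ρ)).variance_fun_comp hGL.aestronglyMeasurable.aemeasurable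
  -- Given `s`, `V` is a weighted sum of independent centred variables, and its mean vanishes for
  -- every `s`, so averaging the conditional variances loses nothing.
  have hVarV : Var[V; Γ.prod Ρ] = Var[id; ρ] * ∫ s, ∑ j, drepCoeff α β j s ^ 2 ∂Γ := by
    rw [variance_eq_sub hVL, hV0, zero_pow two_ne_zero, sub_zero]
    simp only [Pi.pow_apply]
    rw [integral_prod _ hVL.integrable_sq, ← integral_const_mul]
    congr 1
    ext s
    have hL2 : ∀ j : Fin N, MemLp (fun x => drepCoeff α β j s * x) 2 ρ :=
      fun j => hρ.const_mul _
    have e1 := variance_sum_pi (μ := fun _ : Fin N => ρ) hL2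
    have e2 : (∑ j : Fin N, fun r : Fin N → ℝ => drepCoeff α β j s * r j) = fun r => V (s, r) := by
      ext r; simp [hV]
    have hVs : MemLp (fun r => V (s, r)) 2 Ρ :=
      memLp_finsetSum _ fun j _ => (memLp_eval_pi hρ j).const_mul (drepCoeff α β j s)
    rw [e2, variance_eq_sub hVs, hVin, zero_pow two_ne_zero, sub_zero] at e1
    simp only [Pi.pow_apply] at e1
    rw [e1, Finset.mul_sum]
    refine Finset.sum_congr rfl fun j _ => ?_
    rw [variance_const_mul, mul_comm]
    rfl
  refine ⟨hT ▸ hGL'.add hVL, ?_, ?_⟩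
  · refine ⟨∫ s, (1 - A s) ∂Γ, ∫ s, H s ∂Γ, integral_nonneg fun s => sub_nonneg.2 (hA1 s),
      (integral_mono ((integrable_const _).sub (hAL.integrable one_le_two)) hQI hAQ).trans hconc,
      ?_, ?_⟩
    · refine abs_le_of_sq_le_sq ?_ hL.le
      have := variance_nonneg H Γ
      rw [variance_eq_sub hHL, sub_nonneg] at this
      exact this.trans ((integral_mono hHL.integrable_sq integrable_softmax_mul_sq hH2).trans h)
    · rw [hT, integral_add (hGL'.integrable one_le_two) (hVL.integrable one_le_two), hV0, hEG,
        integral_add ((hAL.integrable one_le_two).const_mul _)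
          ((hHL.integrable one_le_two).const_mul _), integral_const_mul, integral_const_mul,
        integral_sub (integrable_const _) (hAL.integrable one_le_two)]
      simp
  · have hsqI : Integrable (fun s => ∑ j, drepCoeff α β j s ^ 2) Γ := by
      refine .of_bound (by fun_prop) 1 (ae_of_all _ fun s => ?_)
      rw [Real.norm_of_nonneg (Finset.sum_nonneg fun j _ => sq_nonneg _)]
      exact sum_drepCoeff_sq_le_one hN h0 h1 s
    refine ⟨∫ s, (1 - ∑ j, drepCoeff α β j s ^ 2) ∂Γ, Var[G; Γ],
      integral_nonneg fun s => sub_nonneg.2 (sum_drepCoeff_sq_le_one hN h0 h1 s), ?_,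
      variance_nonneg _ _, ?_, ?_⟩
    · refine (integral_mono ((integrable_const _).sub hsqI) (hQI.const_mul 3)
        fun s => one_sub_sum_drepCoeff_sq_le hN h0 s).trans ?_
      rw [integral_const_mul]
      gcongr
    -- The variance is at most the second moment about μ, and `G - μ = -μ * (1 - A) + c * H` is
    -- small on average.
    · rw [← variance_sub_const hGL.aestronglyMeasurable μ]
      refine (variance_le_expectation_sq (by fun_prop)).trans ?_
      calc ∫ s, ((fun s => G s - μ) ^ 2) s ∂Γ
          ≤ ∫ s, (2 * μ ^ 2 * Q s + 2 * c ^ 2 * ∑ j, softmax β j s * s j ^ 2) ∂Γ := by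
            refine integral_mono (hGL.sub (memLp_const μ)).integrable_sq
              ((hQI.const_mul _).add (integrable_softmax_mul_sq.const_mul _)) fun s => ?_
            have e1 : (1 - A s) ^ 2 ≤ Q s := by nlinarith [hA0 s, hA1 s, hAQ s]
            have e2 := mul_le_mul_of_nonneg_left e1 (sq_nonneg μ)
            have e3 := mul_le_mul_of_nonneg_left (hH2 s) (sq_nonneg c)
            simp only [Pi.pow_apply, hG]
            nlinarith [sq_nonneg (μ * (1 - A s) + c * H s)]
        _ ≤ _ := by
            rw [integral_add (hQI.const_mul _) (integrable_softmax_mul_sq.const_mul _),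
              integral_const_mul, integral_const_mul]
            gcongr
    · rw [hT, variance_fun_add hGL' hVL, covariance_eq_sub hGL' hVL, hV0, hVarG, hVarV,
        integral_sub (integrable_const _) hsqI]
      simp only [Pi.mul_apply, hGV]
      simp
      ring

end Estimator

/-! ### Limits and derivatives of Gaussian variables. -/

section GaussianLimit

variable {Ω : Type*} [MeasurableSpace Ω] {P : Measure Ω}

/-- The mean of a Gaussian variable is controlled by its variance and by the mass it puts near the
origin. -/
lemma sq_integral_mul_integral_exp_neg_sq_le [IsProbabilityMeasure P] {Q : Ω → ℝ}
    (hQ : MemLp Q 2 P) :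
    (∫ ω, Q ω ∂P) ^ 2 * ∫ ω, Real.exp (-Q ω ^ 2) ∂P ≤ 2 + 2 * Var[Q; P] := by
  set m := ∫ ω, Q ω ∂P with hm
  have hQm := hQ.aestronglyMeasurable.aemeasurable
  have hi : Integrable (fun ω => Real.exp (-Q ω ^ 2)) P := by
    refine .of_bound (by fun_prop) 1 (ae_of_all _ fun ω => ?_)
    rw [Real.norm_of_nonneg (Real.exp_pos _).le]
    exact Real.exp_le_one_iff.2 (by nlinarith [sq_nonneg (Q ω)])
  have hi2 : Integrable (fun ω => (Q ω - m) ^ 2) P := (hQ.sub (memLp_const m)).integrable_sq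
  rw [variance_eq_integral hQm, ← integral_const_mul, ← integral_const_mul]
  -- Pointwise: m² ≤ 2Q² + 2(Q - m)², multiplied by exp(-Q²), with Q² exp(-Q²) ≤ 1.
  calc ∫ ω, m ^ 2 * Real.exp (-Q ω ^ 2) ∂P ≤ ∫ ω, (2 + 2 * (Q ω - m) ^ 2) ∂P := by
        refine integral_mono (hi.const_mul _) ((integrable_const _).add (hi2.const_mul _))
          fun ω => ?_
        have h1 : Real.exp (-Q ω ^ 2) ≤ 1 := Real.exp_le_one_iff.2 (by nlinarith [sq_nonneg (Q ω)])
        have h2 : Q ω ^ 2 * Real.exp (-Q ω ^ 2) ≤ 1 := by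
          have := Real.add_one_le_exp (Q ω ^ 2)
          rw [Real.exp_neg, ← div_eq_mul_inv, div_le_one (Real.exp_pos _)]
          linarith
        have h3 := Real.exp_pos (-Q ω ^ 2)
        have h4 : m ^ 2 ≤ 2 * Q ω ^ 2 + 2 * (Q ω - m) ^ 2 := by nlinarith [sq_nonneg (2 * Q ω - m)]
        have h5 := mul_le_mul_of_nonneg_right h4 h3.le
        have h6 := mul_le_mul_of_nonneg_left h1 (sq_nonneg (Q ω - m))
        simp only
        nlinarith
    _ = 2 + ∫ ω, 2 * (Q ω - m) ^ 2 ∂P := by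
        rw [integral_add (integrable_const _) (hi2.const_mul _)]; simp

/-- Dominated convergence with integrands of modulus one, so no moment bound is needed. -/
lemma tendsto_charFun_map_of_tendsto_ae [IsProbabilityMeasure P] {Q : ℕ → Ω → ℝ} {Y : Ω → ℝ}
    (hQ : ∀ n, AEMeasurable (Q n) P)
    (h : ∀ᵐ ω ∂P, Tendsto (fun n => Q n ω) atTop (𝓝 (Y ω))) (t : ℝ) :
    Tendsto (fun n => charFun (P.map (Q n)) t) atTop (𝓝 (charFun (P.map Y) t)) := by
  have hY : AEMeasurable Y P := aemeasurable_of_tendsto_metrizable_ae _ hQ h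
  have e : ∀ {Z : Ω → ℝ}, AEMeasurable Z P →
      charFun (P.map Z) t = ∫ ω, Complex.exp (t * Z ω * Complex.I) ∂P := fun hZ => by
    rw [charFun_apply_real, integral_map hZ (by fun_prop)]
  rw [e hY]
  simp only [e (hQ _)]
  refine tendsto_integral_of_dominated_convergence (fun _ => 1) (fun n => ?_) (integrable_const _)
    (fun n => ae_of_all _ fun ω => ?_) ?_
  · have := hQ n
    exact AEMeasurable.aestronglyMeasurable (by fun_prop)
  · rw [← Complex.ofReal_mul, Complex.norm_exp_ofReal_mul_I]
  · filter_upwards [h] with ω hω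
    have hc : Continuous fun x : ℝ => Complex.exp (t * x * Complex.I) := by fun_prop
    exact (hc.tendsto _).comp hω

/-- An almost sure limit of Gaussian variables is Gaussian, and the means and variances
converge. -/
theorem hasGaussianLaw_of_tendsto_ae {Q : ℕ → Ω → ℝ} {Y : Ω → ℝ}
    (hQ : ∀ n, HasGaussianLaw (Q n) P)
    (h : ∀ᵐ ω ∂P, Tendsto (fun n => Q n ω) atTop (𝓝 (Y ω))) :
    HasGaussianLaw Y P ∧ Tendsto (fun n => ∫ ω, Q n ω ∂P) atTop (𝓝 (∫ ω, Y ω ∂P)) ∧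
      Tendsto (fun n => Var[Q n; P]) atTop (𝓝 Var[Y; P]) := by
  have hP : IsProbabilityMeasure P := (hQ 0).isProbabilityMeasure
  have hQm : ∀ n, AEMeasurable (Q n) P := fun n => (hQ n).aemeasurable
  have hY : AEMeasurable Y P := aemeasurable_of_tendsto_metrizable_ae _ hQm h
  have hPY : IsProbabilityMeasure (P.map Y) := Measure.isProbabilityMeasure_map hY
  have hchar := fun t => tendsto_charFun_map_of_tendsto_ae hQm h t
  have hcf : ∀ n t, charFun (P.map (Q n)) t =
      Complex.exp (t * (∫ ω, Q n ω ∂P : ℝ) * Complex.I - Var[Q n; P] * t ^ 2 / 2) := fun n t => by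
    rw [(hQ n).map_eq_gaussianReal, charFun_gaussianReal, Real.coe_toNNReal _ (variance_nonneg _ _)]
  -- the variances converge
  obtain ⟨v, hv0, hv⟩ : ∃ v, 0 ≤ v ∧ Tendsto (fun n => Var[Q n; P]) atTop (𝓝 v) := by
    -- The modulus of a Gaussian characteristic function is exp(-Var t²/2). At a nonzero t where the
    -- limit does not vanish, taking logarithms recovers the variance.
    obtain ⟨t, ht0, ht⟩ : ∃ t : ℝ, t ≠ 0 ∧ charFun (P.map Y) t ≠ 0 := by
      have hc : ContinuousAt (charFun (P.map Y)) 0 := continuous_charFun.continuousAt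
      have hne : ∀ᶠ t in 𝓝 (0 : ℝ), charFun (P.map Y) t ≠ 0 :=
        hc.eventually_ne (by simp)
      obtain ⟨t, h1, h2⟩ := ((hne.filter_mono nhdsWithin_le_nhds).and
        (self_mem_nhdsWithin : {(0 : ℝ)}ᶜ ∈ 𝓝[≠] 0)).exists
      exact ⟨t, h2, h1⟩
    have h1 : Tendsto (fun n => Real.log ‖charFun (P.map (Q n)) t‖) atTop
        (𝓝 (Real.log ‖charFun (P.map Y) t‖)) :=
      (hchar t).norm.log (norm_ne_zero_iff.2 ht)
    have h2 : ∀ n, Var[Q n; P] = -2 / t ^ 2 * Real.log ‖charFun (P.map (Q n)) t‖ := fun n => by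
      rw [hcf, Complex.norm_exp, Real.log_exp]
      have : (t * (∫ ω, Q n ω ∂P : ℝ) * Complex.I - Var[Q n; P] * t ^ 2 / 2 : ℂ).re =
          -(Var[Q n; P] * t ^ 2 / 2) := by
        have : (Var[Q n; P] * t ^ 2 / 2 : ℂ) = ((Var[Q n; P] * t ^ 2 / 2 : ℝ) : ℂ) := by push_cast; ring
        rw [this, ← Complex.ofReal_mul, Complex.sub_re, Complex.re_ofReal_mul, Complex.ofReal_re]
        simp
      rw [this]
      field_simp
    have h3 := (tendsto_congr h2).2 (h1.const_mul (-2 / t ^ 2))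
    exact ⟨_, ge_of_tendsto' h3 fun n => variance_nonneg _ _, h3⟩
  -- the means are bounded
  have hbdd : ∃ M, ∀ᶠ n in atTop, |∫ ω, Q n ω ∂P| ≤ M := by
    have h1 : Tendsto (fun n => ∫ ω, Real.exp (-Q n ω ^ 2) ∂P) atTop
        (𝓝 (∫ ω, Real.exp (-Y ω ^ 2) ∂P)) := by
      refine tendsto_integral_of_dominated_convergence (fun _ => 1) (fun n => ?_)
        (integrable_const _) (fun n => ae_of_all _ fun ω => ?_) ?_
      · have := hQm n
        exact AEMeasurable.aestronglyMeasurable (by fun_prop)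
      · rw [Real.norm_of_nonneg (Real.exp_pos _).le]
        exact Real.exp_le_one_iff.2 (by nlinarith [sq_nonneg (Q n ω)])
      · filter_upwards [h] with ω hω
        exact ((hω.pow 2).neg).rexp
    have hpos : 0 < ∫ ω, Real.exp (-Y ω ^ 2) ∂P := by
      refine integral_exp_pos (.of_bound (by fun_prop) 1 (ae_of_all _ fun ω => ?_))
      rw [Real.norm_of_nonneg (Real.exp_pos _).le]
      exact Real.exp_le_one_iff.2 (by nlinarith [sq_nonneg (Y ω)])
    set δ := ∫ ω, Real.exp (-Y ω ^ 2) ∂P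
    refine ⟨√((2 + 2 * (v + 1)) / (δ / 2)), ?_⟩
    filter_upwards [h1.eventually_const_lt (half_lt_self hpos),
      hv.eventually_lt_const (lt_add_one v)] with n hn1 hn2
    refine Real.abs_le_sqrt ?_
    rw [le_div_iff₀ (by positivity)]
    have := sq_integral_mul_integral_exp_neg_sq_le (hQ n).memLp_two
    nlinarith [mul_le_mul_of_nonneg_left hn1.le (sq_nonneg (∫ ω, Q n ω ∂P))]
  -- Every subsequence of means has a convergent further subsequence, and the law of `Y` determines
  -- its limit; hence the full sequence of means converges.
  have key : ∀ ns : ℕ → ℕ, Tendsto ns atTop atTop → ∃ (ms : ℕ → ℕ) (m : ℝ),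
      Tendsto (fun n => ∫ ω, Q (ns (ms n)) ω ∂P) atTop (𝓝 m) ∧
        P.map Y = gaussianReal m v.toNNReal := by
    intro ns hns
    obtain ⟨M, hM⟩ := hbdd
    obtain ⟨m, -, ms, hms, hlim⟩ := tendsto_subseq_of_frequently_bounded
      (x := fun n => ∫ ω, Q (ns n) ω ∂P) (Metric.isBounded_closedBall (x := (0 : ℝ)) (r := M))
      ((hns.eventually hM).frequently.mono fun n hn => by simpa using hn)
    refine ⟨ms, m, hlim, Measure.ext_of_charFun (funext fun t => ?_)⟩
    have hsub := hns.comp hms.tendsto_atTop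
    refine tendsto_nhds_unique ((hchar t).comp hsub) ?_
    rw [charFun_gaussianReal, Real.coe_toNNReal _ hv0]
    simp only [Function.comp_def, hcf]
    have hv' := hv.comp hsub
    have c1 := (Complex.continuous_ofReal.tendsto _).comp hlim
    have c2 := (Complex.continuous_ofReal.tendsto _).comp hv'
    exact (((c1.const_mul (t : ℂ)).mul_const Complex.I).sub
      ((c2.mul_const _).div_const _)).cexp
  have hm : ∀ m, P.map Y = gaussianReal m v.toNNReal → m = ∫ ω, Y ω ∂P := fun m hm => by
    have := integral_map hY (f := fun x : ℝ => x) aestronglyMeasurable_id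
    rw [← this, hm, integral_id_gaussianReal]
  obtain ⟨ms, m, -, hlaw⟩ := key id tendsto_id
  refine ⟨⟨hlaw ▸ inferInstance⟩, ?_, ?_⟩
  · refine tendsto_of_subseq_tendsto fun ns hns => ?_
    obtain ⟨ms, m, h1, h2⟩ := key ns hns
    exact ⟨ms, hm m h2 ▸ h1⟩
  · have : Var[Y; P] = v := by
      have e := variance_map (X := id) (μ := P) (Y := Y) aestronglyMeasurable_id.aemeasurable hY
      rw [Function.id_comp] at e
      rw [← e, hlaw, variance_id_gaussianReal, Real.coe_toNNReal _ hv0]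
    rwa [this]

/-- Gaussianity of a vector is tested on linear functionals, which reduces the claim to the scalar
limit theorem. -/
theorem hasGaussianLaw_prodMk_of_tendsto_ae {X : Ω → ℝ} {Q : ℕ → Ω → ℝ} {Y : Ω → ℝ}
    (hQ : ∀ n, HasGaussianLaw (fun ω => (X ω, Q n ω)) P)
    (h : ∀ᵐ ω ∂P, Tendsto (fun n => Q n ω) atTop (𝓝 (Y ω))) :
    HasGaussianLaw (fun ω => (X ω, Y ω)) P := by
  have hX : AEMeasurable X P := (hQ 0).fst.aemeasurable
  have hY : AEMeasurable Y P :=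
    aemeasurable_of_tendsto_metrizable_ae _ (fun n => (hQ n).snd.aemeasurable) h
  refine ⟨isGaussian_of_isGaussian_map fun L => ?_⟩
  rw [AEMeasurable.map_map_of_aemeasurable (by fun_prop) (by fun_prop)]
  refine (hasGaussianLaw_of_tendsto_ae (fun n => (hQ n).map L) ?_).1.isGaussian_map
  filter_upwards [h] with ω hω
  exact (L.continuous.tendsto _).comp (tendsto_const_nhds.prodMk_nhds hω)

lemma log_integral_exp_of_hasGaussianLaw {X : Ω → ℝ} (hX : HasGaussianLaw X P) :
    Real.log (∫ ω, Real.exp (X ω) ∂P) = ∫ ω, X ω ∂P + Var[X; P] / 2 := by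
  have := mgf_gaussianReal hX.map_eq_gaussianReal 1
  simp only [mgf, one_mul] at this
  rw [this, Real.log_exp, Real.coe_toNNReal _ (variance_nonneg _ _)]
  ring

/-- If a family of Gaussian variables is almost surely differentiable at a point, then the
derivative is jointly Gaussian with the value, and the log-Laplace transform can be differentiated
under the expectation. -/
theorem hasGaussianLaw_deriv {g : ℝ → Ω → ℝ} {D : Ω → ℝ} {t₀ : ℝ}
    (hg : ∀ᶠ t in 𝓝 t₀, HasGaussianLaw (fun ω => (g t₀ ω, g t ω)) P)
    (hD : ∀ᵐ ω ∂P, HasDerivAt (fun t => g t ω) (D ω) t₀) :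
    HasGaussianLaw (fun ω => (g t₀ ω, D ω)) P ∧
      HasDerivAt (fun t => Real.log (∫ ω, Real.exp (g t ω) ∂P))
        (∫ ω, D ω ∂P + cov[g t₀, D; P]) t₀ := by
  set q : ℝ → Ω → ℝ := fun t ω => (t - t₀)⁻¹ * (g t ω - g t₀ ω) with hq
  have hP : IsProbabilityMeasure P := hg.self_of_nhds.isProbabilityMeasure
  have hX : HasGaussianLaw (g t₀) P := hg.self_of_nhds.fst
  have hpair : ∀ t, HasGaussianLaw (fun ω => (g t₀ ω, g t ω)) P →
      HasGaussianLaw (fun ω => (g t₀ ω, q t ω)) P := fun t ht => by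
    exact ht.map_fun ((ContinuousLinearMap.fst ℝ ℝ ℝ).prod
      ((t - t₀)⁻¹ • (ContinuousLinearMap.snd ℝ ℝ ℝ - ContinuousLinearMap.fst ℝ ℝ ℝ)))
  have hqlim : ∀ᵐ ω ∂P, Tendsto (fun t => q t ω) (𝓝[≠] t₀) (𝓝 (D ω)) := by
    filter_upwards [hD] with ω hω
    simpa [slope_fun_def, hq] using hasDerivAt_iff_tendsto_slope.1 hω
  -- sequences of difference quotients
  have hseq : ∀ u : ℕ → ℝ, Tendsto u atTop (𝓝[≠] t₀) → ∃ n₀,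
      ∀ n, HasGaussianLaw (fun ω => (g t₀ ω, g (u (n + n₀)) ω)) P := fun u hu => by
    obtain ⟨n₀, hn₀⟩ := eventually_atTop.1 (hu.eventually (hg.filter_mono nhdsWithin_le_nhds))
    exact ⟨n₀, fun n => hn₀ _ (Nat.le_add_left _ _)⟩
  have hlaw : HasGaussianLaw (fun ω => (g t₀ ω, D ω)) P := by
    obtain ⟨u, hu⟩ := exists_seq_tendsto (𝓝[≠] t₀)
    obtain ⟨n₀, hn₀⟩ := hseq u hu
    refine hasGaussianLaw_prodMk_of_tendsto_ae (fun n => hpair _ (hn₀ n)) ?_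
    filter_upwards [hqlim] with ω hω
    exact hω.comp ((tendsto_add_atTop_iff_nat n₀).2 hu)
  refine ⟨hlaw, ?_⟩
  have hcongr : (fun t => Real.log (∫ ω, Real.exp (g t ω) ∂P)) =ᶠ[𝓝 t₀]
      fun t => ∫ ω, g t ω ∂P + Var[g t; P] / 2 := by
    filter_upwards [hg] with t ht using log_integral_exp_of_hasGaussianLaw ht.snd
  refine HasDerivAt.congr_of_eventuallyEq ?_ hcongr
  rw [hasDerivAt_iff_tendsto_slope]
  refine tendsto_of_seq_tendsto fun u hu => ?_
  obtain ⟨n₀, hn₀⟩ := hseq u hu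
  rw [← tendsto_add_atTop_iff_nat n₀]
  have hu' := (tendsto_add_atTop_iff_nat n₀).2 hu
  have hqP := fun n => hpair _ (hn₀ n)
  have hqD : ∀ᵐ ω ∂P, Tendsto (fun n => q (u (n + n₀)) ω) atTop (𝓝 (D ω)) := by
    filter_upwards [hqlim] with ω hω using hω.comp hu'
  obtain ⟨-, hm, hv⟩ := hasGaussianLaw_of_tendsto_ae (fun n => (hqP n).snd) hqD
  -- Variances of `g t₀ + q` also converge, so polarization gives convergence of the covariances.
  obtain ⟨-, -, hv'⟩ := hasGaussianLaw_of_tendsto_ae (Y := fun ω => g t₀ ω + D ω)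
    (fun n => (hqP n).fun_add) (by filter_upwards [hqD] with ω hω using hω.const_add _)
  have hcov : ∀ Y, HasGaussianLaw (fun ω => (g t₀ ω, Y ω)) P →
      cov[g t₀, Y; P] = (Var[fun ω => g t₀ ω + Y ω; P] - Var[g t₀; P] - Var[Y; P]) / 2 := by
    intro Y hY
    rw [variance_fun_add hX.memLp_two hY.snd.memLp_two]
    ring
  have hlim : Tendsto (fun n => u (n + n₀) - t₀) atTop (𝓝 0) := by
    simpa using (hu'.mono_right nhdsWithin_le_nhds).sub_const t₀
  have hne : ∀ᶠ n in atTop, u (n + n₀) ≠ t₀ := hu'.eventually eventually_mem_nhdsWithin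
  -- The slope of mean plus half the variance is E q + cov(g t₀, q) + (t - t₀)/2 · Var q; the last
  -- term vanishes because the variances of `q` converge.
  have hfin := (hm.add (((hv'.sub_const Var[g t₀; P]).sub hv).div_const 2)).add
    ((hlim.div_const 2).mul hv)
  rw [zero_div, zero_mul, add_zero, ← hcov _ hlaw] at hfin
  refine hfin.congr' ?_
  filter_upwards [hne] with n hn
  have hn' : u (n + n₀) - t₀ ≠ 0 := sub_ne_zero.2 hn
  set t := u (n + n₀)
  have hdec : g t = fun ω => g t₀ ω + (t - t₀) * q t ω := by
    ext ω
    simp only [hq]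
    rw [mul_inv_cancel_left₀ hn']
    ring
  have hq2 := (hqP n).snd.memLp_two
  have hvar : Var[g t; P] = Var[g t₀; P] + 2 * ((t - t₀) * cov[g t₀, q t; P]) +
      (t - t₀) ^ 2 * Var[q t; P] := by
    rw [hdec, variance_fun_add hX.memLp_two (hq2.const_mul _), covariance_const_mul_right,
      variance_const_mul]
  have hmean : ∫ ω, g t ω ∂P = ∫ ω, g t₀ ω ∂P + (t - t₀) * ∫ ω, q t ω ∂P := by
    rw [hdec, integral_add hX.integrable ((hq2.integrable one_le_two).const_mul _),
      integral_const_mul]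
  change _ = slope (fun t => ∫ ω, g t ω ∂P + Var[g t; P] / 2) t₀ t
  rw [slope_def_field, hvar, hmean, ← hcov _ (hqP n)]
  field_simp
  ring

end GaussianLimit

/-! ### From one Gaussian pair to the estimator on N samples. -/

section Samples

variable {Ω : Type*} [MeasurableSpace Ω] {P : Measure Ω}

/-- The joint law of the samples of two independent variables. -/
lemma hasLaw_samples_of_indepFun [IsProbabilityMeasure P] {S R : Ω → ℝ}
    (hS : HasLaw S (gaussianReal 0 1) P) (hR : AEMeasurable R P) (hSR : IndepFun S R P) (N : ℕ) :
    HasLaw (fun (ε : Fin N → Ω) => (fun j => S (ε j), fun j => R (ε j)))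
      ((stdGaussianPi N).prod (Measure.pi fun _ => P.map R)) (Measure.pi fun _ => P) := by
  have hρ : IsProbabilityMeasure (P.map R) := Measure.isProbabilityMeasure_map hR
  have hSRm : AEMeasurable (fun ω => (S ω, R ω)) P := hS.aemeasurable.prodMk hR
  have hmap : P.map (fun ω => (S ω, R ω)) = (gaussianReal 0 1).prod (P.map R) := by
    rw [(indepFun_iff_map_prod_eq_prod_map_map hS.aemeasurable hR).1 hSR, hS.map_eq]
  have hprob : IsProbabilityMeasure (P.map fun ω => (S ω, R ω)) :=
    Measure.isProbabilityMeasure_map hSRm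
  have h1 : HasLaw (fun (ε : Fin N → Ω) j => (S (ε j), R (ε j)))
      (Measure.pi fun _ => (gaussianReal 0 1).prod (P.map R)) (Measure.pi fun _ => P) := by
    refine ⟨aemeasurable_pi_lambda _ fun j =>
      hSRm.comp_quasiMeasurePreserving (Measure.quasiMeasurePreserving_eval _ j), ?_⟩
    rw [Measure.pi_map_pi (fun _ => hSRm), hmap]
  exact (measurePreserving_arrowProdEquivProdArrow ℝ ℝ (Fin N) (fun _ => gaussianReal 0 1)
    (fun _ => P.map R)).hasLaw.comp h1

/-- The estimator `∑_j (α W_j + (1 - α) W_j²) D(ε_j)`, where `W` is the softmax of the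
variables `(1 - α) X(ε_j)`. -/
def drepSum (α : ℝ) (X D : Ω → ℝ) (N : ℕ) (ε : Fin N → Ω) : ℝ :=
  ∑ j, drepCoeff α (1 - α) j (fun l => X (ε l)) * D (ε j)

/-- A common shift cancels in the ratio and a common scale is absorbed by the inverse temperature;
this is how B becomes part of the temperature. -/
lemma softmax_affine {N : ℕ} (β m b : ℝ) (j : Fin N) (s : Fin N → ℝ) :
    softmax β j (fun l => m + b * s l) = softmax (β * b) j s := by
  unfold softmax
  have : ∀ l, Real.exp (β * (m + b * s l)) = Real.exp (β * m) * Real.exp (β * b * s l) := fun l => by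
    rw [← Real.exp_add]; ring_nf
  simp only [this, ← Finset.mul_sum]
  exact mul_div_mul_left _ _ (Real.exp_pos _).ne'

theorem drepSum_estimates {X D : Ω → ℝ} (hXD : HasGaussianLaw (fun ω => (X ω, D ω)) P)
    {α L : ℝ} {N : ℕ} (h0 : 0 ≤ α) (h1 : α < 1) (hN : 0 < N) (hB : 0 < √Var[X; P]) (hL : 0 < L)
    (h : ∫ s, ∑ j : Fin N, softmax ((1 - α) * √Var[X; P]) j s * s j ^ 2 ∂(stdGaussianPi N) ≤ L ^ 2) :
    MemLp (drepSum α X D N) 2 (Measure.pi fun _ => P) ∧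
    (∃ e₁ e₂, 0 ≤ e₁ ∧ e₁ ≤ L / ((1 - α) * √Var[X; P]) ∧ |e₂| ≤ L ∧
      ∫ ε, drepSum α X D N ε ∂(Measure.pi fun _ => P) =
        (∫ ω, D ω ∂P) * (1 - e₁) + cov[X, D; P] / √Var[X; P] * e₂) ∧
    (∃ e₁ e₂, 0 ≤ e₁ ∧ e₁ ≤ 3 * (L / ((1 - α) * √Var[X; P])) ∧ 0 ≤ e₂ ∧
      e₂ ≤ 2 * (∫ ω, D ω ∂P) ^ 2 * (L / ((1 - α) * √Var[X; P])) +
        2 * (cov[X, D; P] / √Var[X; P]) ^ 2 * L ^ 2 ∧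
      Var[drepSum α X D N; Measure.pi fun _ => P] =
        (Var[D; P] - (cov[X, D; P] / √Var[X; P]) ^ 2) * (1 - e₁) + e₂) := by
  have hP : IsProbabilityMeasure P := hXD.isProbabilityMeasure
  have hX := hXD.fst
  have hD := hXD.snd
  set B := √Var[X; P] with hBdef
  have hB2 : Var[X; P] = B ^ 2 := (Real.sq_sqrt (variance_nonneg _ _)).symm
  set c := cov[X, D; P] / B with hc
  have hcB : cov[X, D; P] = c * B := by rw [hc, div_mul_cancel₀ _ hB.ne']
  set m := ∫ ω, X ω ∂P with hm
  set μ := ∫ ω, D ω ∂P with hμ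
  set S : Ω → ℝ := fun ω => B⁻¹ * (X ω - m) with hS
  -- The centred residual of the regression of `D` on `X`, so that D = μ + c S + R.
  set R : Ω → ℝ := fun ω => D ω - c * B⁻¹ * X ω + (c * B⁻¹ * m - μ) with hR
  have hX' : (fun ω => m + B * S ω) = X := by
    ext ω; simp only [hS]; rw [mul_inv_cancel_left₀ hB.ne']; ring
  have hSlaw : HasLaw S (gaussianReal 0 1) P := by
    have hXl : HasLaw X (gaussianReal m Var[X; P].toNNReal) P :=
      ⟨hX.aemeasurable, hX.map_eq_gaussianReal⟩
    have := gaussianReal_const_mul (gaussianReal_sub_const hXl m) B⁻¹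
    convert this using 1
    congr 1
    · simp
    · ext
      simp [hB2]
      field_simp
      exact (max_eq_left (by positivity)).symm
  have hlin : HasGaussianLaw (fun ω => (B⁻¹ * X ω, D ω - c * B⁻¹ * X ω)) P :=
    hXD.map_fun ((B⁻¹ • ContinuousLinearMap.fst ℝ ℝ ℝ).prod
      (ContinuousLinearMap.snd ℝ ℝ ℝ - (c * B⁻¹) • ContinuousLinearMap.fst ℝ ℝ ℝ))
  have hcov : cov[fun ω => B⁻¹ * X ω, fun ω => D ω - c * B⁻¹ * X ω; P] = 0 := by
    rw [covariance_const_mul_left, covariance_fun_sub_right hX.memLp_two hD.memLp_two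
      (hX.memLp_two.const_mul _), covariance_const_mul_right, covariance_self hX.aemeasurable, hcB,
      hB2]
    field_simp
    simp
  -- Uncorrelated components of a Gaussian pair are independent; constant shifts do not matter.
  have hind : IndepFun S R P := by
    have := (hlin.indepFun_of_covariance_eq_zero hcov).comp
      (φ := fun x => x - B⁻¹ * m) (ψ := fun x => x + (c * B⁻¹ * m - μ))
      (by fun_prop) (by fun_prop)
    have e : S = (fun x => x - B⁻¹ * m) ∘ fun ω => B⁻¹ * X ω := by
      ext ω; simp only [hS, Function.comp]; ring
    rw [e]
    exact this
  have hRm : MemLp R 2 P := hlin.snd.memLp_two.add (memLp_const _)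
  have hRae := hRm.aestronglyMeasurable.aemeasurable
  have hρ : IsProbabilityMeasure (P.map R) := Measure.isProbabilityMeasure_map hRae
  have hρ2 : MemLp id 2 (P.map R) :=
    (memLp_map_measure_iff aestronglyMeasurable_id hRae).2 hRm
  have hρ0 : ∫ x, x ∂(P.map R) = 0 := by
    rw [integral_map hRae (f := fun x => x) aestronglyMeasurable_id, integral_add
      hlin.snd.integrable (integrable_const _), integral_sub hD.integrable
      (hX.integrable.const_mul _), integral_const_mul]
    simp [← hm, ← hμ]
  have hρv : Var[id; P.map R] = Var[D; P] - c ^ 2 := by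
    rw [variance_map aemeasurable_id hRae, Function.id_comp,
      variance_add_const hlin.snd.aemeasurable.aestronglyMeasurable,
      variance_fun_sub hD.memLp_two (hX.memLp_two.const_mul _), covariance_const_mul_right,
      variance_const_mul, covariance_comm, hcB, hB2]
    field_simp
    ring
  have hlaw := hasLaw_samples_of_indepFun hSlaw hRae hind N
  have hsum : drepSum α X D N = drepStd (N := N) α ((1 - α) * B) μ c ∘
      fun ε => (fun j => S (ε j), fun j => R (ε j)) := by
    ext ε
    simp only [drepSum, drepStd, Function.comp]
    refine Finset.sum_congr rfl fun j _ => ?_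
    have e1 : drepCoeff α (1 - α) j (fun l => X (ε l)) =
        drepCoeff α ((1 - α) * B) j (fun l => S (ε l)) := by
      unfold drepCoeff
      rw [← softmax_affine (1 - α) m B j]
      simp only [congrFun hX']
    rw [e1]
    simp only [hS, hR]
    ring
  obtain ⟨H1, H2, H3⟩ := drepStd_estimates hρ2 hρ0 h0 h1 (mul_pos (by linarith) hB) hN μ c hL h
  refine ⟨?_, ?_, ?_⟩
  · rw [hsum]
    exact (hlaw.map_eq ▸ H1 : MemLp _ 2 (Measure.map _ _)).comp_of_map hlaw.aemeasurable
  · rw [hsum, hlaw.integral_comp H1.aestronglyMeasurable]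
    exact H2
  · rw [hsum, ← variance_map (hlaw.map_eq ▸ H1.aestronglyMeasurable.aemeasurable) hlaw.aemeasurable,
      hlaw.map_eq, ← hρv]
    exact H3

end Samples

/-! ### Reduction of the latent variable model to the Gaussian pair. -/

namespace LatentModel

variable {E : Type*} [MeasurableSpace E] {d : ℕ} {𝓜 : LatentModel E d}

/-- The law of `f ε φ'` has a density with respect to `ν`, so ν-null sets are avoided even when `φ'`
differs from `φ`. -/
lemma Standing.ae_pos (h : 𝓜.Standing) {θ : Fin 𝓜.a → ℝ} (hθ : θ ∈ 𝓜.Θ) {φ φ' : Fin 𝓜.b → ℝ}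
    (hφ : φ ∈ 𝓜.Φ) (hφ' : φ' ∈ 𝓜.Φ) :
    ∀ᵐ ε ∂𝓜.noise, 0 < 𝓜.posterior θ (𝓜.f ε φ') ∧ 0 < 𝓜.q φ (𝓜.f ε φ') := by
  have hlaw := h.hasLaw_f φ' hφ'
  refine ae_of_ae_map hlaw.aemeasurable (p := fun z => 0 < 𝓜.posterior θ z ∧ 0 < 𝓜.q φ z) ?_
  rw [hlaw.map_eq]
  exact (withDensity_absolutelyContinuous _ _).ae_le ((h.posterior_pos θ hθ).and (h.q_pos φ hφ))

/-- Positivity of the evidence is read off a positive posterior value: the numerator is nonnegative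
and division by zero would give 0. -/
lemma Standing.joint_pos_of_posterior_pos (h : 𝓜.Standing) {θ : Fin 𝓜.a → ℝ} (hθ : θ ∈ 𝓜.Θ)
    {z : Fin d → ℝ} (hz : 0 < 𝓜.posterior θ z) : 0 < 𝓜.joint θ z ∧ 0 < 𝓜.evidence θ := by
  have hj := h.joint_nonneg θ hθ z
  unfold posterior at hz
  have hj' : 0 < 𝓜.joint θ z := hj.lt_of_ne fun e => by simp [← e] at hz
  exact ⟨hj', (div_pos_iff_of_pos_left hj').1 hz⟩

lemma Standing.ae_weight_pos (h : 𝓜.Standing) {θ : Fin 𝓜.a → ℝ} (hθ : θ ∈ 𝓜.Θ)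
    {φ φ' : Fin 𝓜.b → ℝ} (hφ : φ ∈ 𝓜.Φ) (hφ' : φ' ∈ 𝓜.Φ) :
    ∀ᵐ ε ∂𝓜.noise, 0 < 𝓜.weight θ φ (𝓜.f ε φ') := by
  filter_upwards [h.ae_pos hθ hφ hφ'] with ε hε
  exact div_pos (h.joint_pos_of_posterior_pos hθ hε.1).1 hε.2

lemma Standing.eventually_update_mem (h : 𝓜.Standing) {φ : Fin 𝓜.b → ℝ} (hφ : φ ∈ 𝓜.Φ)
    (k : Fin 𝓜.b) : ∀ᶠ t in 𝓝 (φ k), Function.update φ k t ∈ 𝓜.Φ := by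
  have hc : Continuous fun t => Function.update φ k t := by fun_prop
  refine hc.continuousAt.eventually_mem ?_
  rw [Function.update_eq_self]
  exact h.isOpen_Φ.mem_nhds hφ

lemma Standing.ae_hasDerivAt_logW (h : 𝓜.Standing) {θ : Fin 𝓜.a → ℝ} (hθ : θ ∈ 𝓜.Θ)
    {φ : Fin 𝓜.b → ℝ} (hφ : φ ∈ 𝓜.Φ) (k : Fin 𝓜.b) :
    ∀ᵐ ε ∂𝓜.noise, HasDerivAt (fun t => 𝓜.logW θ φ (Function.update φ k t) ε)
      (𝓜.dlogW k θ φ φ ε) (φ k) := by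
  filter_upwards [h.ae_pos hθ hφ hφ, h.differentiable_f] with ε hε hf
  obtain ⟨hj, he⟩ := h.joint_pos_of_posterior_pos hθ hε.1
  refine DifferentiableAt.hasDerivAt ?_
  have hupd : DifferentiableAt ℝ (fun t => Function.update φ k t) (φ k) :=
    (hasDerivAt_update φ k (φ k)).differentiableAt
  have hz : DifferentiableAt ℝ (fun t => 𝓜.f ε (Function.update φ k t)) (φ k) := by
    refine DifferentiableAt.comp (φ k) (g := 𝓜.f ε) ?_ hupd
    rw [Function.update_eq_self]
    exact hf.differentiableAt (h.isOpen_Φ.mem_nhds hφ)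
  have hpost : ∀ z, DifferentiableAt ℝ (𝓜.posterior θ) z := fun z => by
    have h1 := h.differentiable_posterior.differentiableAt (x := (z, θ))
      ((isOpen_univ.prod h.isOpen_Θ).mem_nhds ⟨Set.mem_univ _, hθ⟩)
    exact h1.comp z (f := fun z => (z, θ)) (by fun_prop)
  have hq : ∀ z, DifferentiableAt ℝ (𝓜.q φ) z := fun z => by
    have h1 := h.differentiable_q.differentiableAt (x := (z, φ))
      ((isOpen_univ.prod h.isOpen_Φ).mem_nhds ⟨Set.mem_univ _, hφ⟩)
    exact h1.comp z (f := fun z => (z, φ)) (by fun_prop)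
  -- Differentiability is assumed of the posterior, not of the joint density, so the weight is
  -- rewritten through the posterior.
  have hw : 𝓜.weight θ φ = fun z => 𝓜.evidence θ * 𝓜.posterior θ z / 𝓜.q φ z := by
    ext z
    rw [weight, posterior, mul_div_cancel₀ _ he.ne']
  have hwd : DifferentiableAt ℝ (𝓜.weight θ φ) (𝓜.f ε φ) := by
    rw [hw]
    simp only [div_eq_mul_inv]
    exact ((hpost _).const_mul _).mul ((hq _).inv hε.2.ne')
  refine DifferentiableAt.log ?_ ?_
  · refine DifferentiableAt.comp (φ k) (g := 𝓜.weight θ φ) ?_ hz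
    rwa [Function.update_eq_self]
  · rw [Function.update_eq_self]
    exact (div_pos hj hε.2).ne'

/-- The log-weight and its gradient are jointly Gaussian, and the gradient of the log-mean weight
is the mean of the gradient plus its covariance with the log-weight. -/
theorem Standing.hasGaussianLaw_logW_dlogW (h : 𝓜.Standing) (hG : 𝓜.GaussianField)
    {θ : Fin 𝓜.a → ℝ} (hθ : θ ∈ 𝓜.Θ) {φ : Fin 𝓜.b → ℝ} (hφ : φ ∈ 𝓜.Φ) (k : Fin 𝓜.b) :
    HasGaussianLaw (fun ε => (𝓜.logW θ φ φ ε, 𝓜.dlogW k θ φ φ ε)) 𝓜.noise ∧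
      𝓜.dlogMeanW k θ φ = ∫ ε, 𝓜.dlogW k θ φ φ ε ∂𝓜.noise +
        cov[𝓜.logW θ φ φ, 𝓜.dlogW k θ φ φ; 𝓜.noise] := by
  have hupd := h.eventually_update_mem hφ k
  have key := hasGaussianLaw_deriv (P := 𝓜.noise)
    (g := fun t ε => 𝓜.logW θ φ (Function.update φ k t) ε) (D := 𝓜.dlogW k θ φ φ) (t₀ := φ k)
    ?_ (h.ae_hasDerivAt_logW hθ hφ k)
  · rw [Function.update_eq_self] at key
    refine ⟨key.1, ?_⟩
    have hcongr : (fun t => Real.log (∫ ε, 𝓜.tw θ φ (Function.update φ k t) ε ∂𝓜.noise))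
        =ᶠ[𝓝 (φ k)] fun t => Real.log
          (∫ ε, Real.exp (𝓜.logW θ φ (Function.update φ k t) ε) ∂𝓜.noise) := by
      filter_upwards [hupd] with t ht
      congr 1
      refine integral_congr_ae ?_
      filter_upwards [h.ae_weight_pos hθ hφ ht] with ε hε
      exact (Real.exp_log hε).symm
    exact (key.2.congr_of_eventuallyEq hcongr).deriv
  · filter_upwards [hupd] with t ht
    rw [Function.update_eq_self]
    exact hG.hasGaussianLaw_prodMk (s := (⟨θ, hθ⟩, ⟨φ, hφ⟩, ⟨φ, hφ⟩))
      (t := (⟨θ, hθ⟩, ⟨φ, hφ⟩, ⟨_, ht⟩))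

lemma Standing.drep_ae_eq_drepSum (h : 𝓜.Standing) {θ : Fin 𝓜.a → ℝ} (hθ : θ ∈ 𝓜.Θ)
    {φ : Fin 𝓜.b → ℝ} (hφ : φ ∈ 𝓜.Φ) (k : Fin 𝓜.b) (α : ℝ) (N : ℕ) :
    𝓜.drep α k θ φ N =ᵐ[𝓜.sampleLaw N]
      drepSum α (𝓜.logW θ φ φ) (𝓜.dlogW k θ φ φ) N := by
  have := h.isProbabilityMeasure_noise
  have hpos : ∀ᵐ ε ∂𝓜.sampleLaw N, ∀ j, 0 < 𝓜.weight θ φ (𝓜.f (ε j) φ) :=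
    ae_all_iff.2 fun j => (Measure.quasiMeasurePreserving_eval (fun _ : Fin N => 𝓜.noise) j).ae
      (h.ae_weight_pos hθ hφ hφ)
  filter_upwards [hpos] with ε hε
  have hexp : ∀ j, 𝓜.weight θ φ (𝓜.f (ε j) φ) ^ (1 - α) =
      Real.exp ((1 - α) * 𝓜.logW θ φ φ (ε j)) := fun j => by
    rw [Real.rpow_def_of_pos (hε j), mul_comm]
    rfl
  simp only [drep, drepSum, drepCoeff, normWeight, softmax, hexp]

/-- A single normalized weight is 1, and α + (1 - α) = 1. -/
lemma Standing.drep_one_ae_eq (h : 𝓜.Standing) {θ : Fin 𝓜.a → ℝ} (hθ : θ ∈ 𝓜.Θ)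
    {φ : Fin 𝓜.b → ℝ} (hφ : φ ∈ 𝓜.Φ) (k : Fin 𝓜.b) (α : ℝ) :
    𝓜.drep α k θ φ 1 =ᵐ[𝓜.sampleLaw 1] fun ε => 𝓜.dlogW k θ φ φ (ε 0) := by
  refine (h.drep_ae_eq_drepSum hθ hφ k α 1).trans (.of_eq (funext fun ε => ?_))
  have : softmax (1 - α) (0 : Fin 1) (fun l => 𝓜.logW θ φ φ (ε l)) = 1 := by
    simp [softmax]
  simp [drepSum, drepCoeff, this]

lemma Standing.integral_drep_one (h : 𝓜.Standing) (hG : 𝓜.GaussianField)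
    {θ : Fin 𝓜.a → ℝ} (hθ : θ ∈ 𝓜.Θ) {φ : Fin 𝓜.b → ℝ} (hφ : φ ∈ 𝓜.Φ) (k : Fin 𝓜.b) (α : ℝ) :
    ∫ ε, 𝓜.drep α k θ φ 1 ε ∂𝓜.sampleLaw 1 = ∫ ε, 𝓜.dlogW k θ φ φ ε ∂𝓜.noise := by
  have := h.isProbabilityMeasure_noise
  rw [integral_congr_ae (h.drep_one_ae_eq hθ hφ k α)]
  exact integral_comp_eval (μ := fun _ : Fin 1 => 𝓜.noise) (i := 0)
    (h.hasGaussianLaw_logW_dlogW hG hθ hφ k).1.snd.aemeasurable.aestronglyMeasurable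

lemma Standing.variance_drep_one (h : 𝓜.Standing) (hG : 𝓜.GaussianField)
    {θ : Fin 𝓜.a → ℝ} (hθ : θ ∈ 𝓜.Θ) {φ : Fin 𝓜.b → ℝ} (hφ : φ ∈ 𝓜.Φ) (k : Fin 𝓜.b) (α : ℝ) :
    Var[𝓜.drep α k θ φ 1; 𝓜.sampleLaw 1] = Var[𝓜.dlogW k θ φ φ; 𝓜.noise] := by
  have := h.isProbabilityMeasure_noise
  rw [variance_congr (h.drep_one_ae_eq hθ hφ k α)]
  exact (measurePreserving_eval (fun _ : Fin 1 => 𝓜.noise) 0).variance_fun_comp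
    (h.hasGaussianLaw_logW_dlogW hG hθ hφ k).1.snd.aemeasurable

lemma Standing.snr_drep_one (h : 𝓜.Standing) (hG : 𝓜.GaussianField)
    {θ : Fin 𝓜.a → ℝ} (hθ : θ ∈ 𝓜.Θ) {φ : Fin 𝓜.b → ℝ} (hφ : φ ∈ 𝓜.Φ) (k : Fin 𝓜.b) (α : ℝ) :
    SNR (𝓜.drep α k θ φ 1) (𝓜.sampleLaw 1) =
      |∫ ε, 𝓜.dlogW k θ φ φ ε ∂𝓜.noise| / √Var[𝓜.dlogW k θ φ φ; 𝓜.noise] := by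
  rw [SNR, h.integral_drep_one hG hθ hφ, h.variance_drep_one hG hθ hφ]

/-- The bias of the single-sample estimator is, up to its sign, the covariance of the log-weight
and its gradient. -/
lemma Standing.snr_drep_one_sub_dlogMeanW (h : 𝓜.Standing) (hG : 𝓜.GaussianField)
    {θ : Fin 𝓜.a → ℝ} (hθ : θ ∈ 𝓜.Θ) {φ : Fin 𝓜.b → ℝ} (hφ : φ ∈ 𝓜.Φ) (k : Fin 𝓜.b) (α : ℝ) :
    SNR (fun ε => 𝓜.drep α k θ φ 1 ε - 𝓜.dlogMeanW k θ φ) (𝓜.sampleLaw 1) =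
      |cov[𝓜.logW θ φ φ, 𝓜.dlogW k θ φ φ; 𝓜.noise]| / √Var[𝓜.dlogW k θ φ φ; 𝓜.noise] := by
  have := h.isProbabilityMeasure_noise
  have hprob : IsProbabilityMeasure (𝓜.sampleLaw 1) := by unfold sampleLaw; infer_instance
  obtain ⟨hlaw, hmean⟩ := h.hasGaussianLaw_logW_dlogW hG hθ hφ k
  have hmp := measurePreserving_eval (fun _ : Fin 1 => 𝓜.noise) 0
  have hae := h.drep_one_ae_eq hθ hφ k α
  have hint : Integrable (𝓜.drep α k θ φ 1) (𝓜.sampleLaw 1) :=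
    (hmp.integrable_comp_of_integrable hlaw.snd.integrable).congr hae.symm
  rw [SNR, variance_sub_const hint.aestronglyMeasurable, h.variance_drep_one hG hθ hφ,
    integral_sub hint (integrable_const _), h.integral_drep_one hG hθ hφ, hmean]
  congr 1
  simp

end LatentModel

/-! ### Asymptotics of the signal-to-noise ratio. -/

section Asymptotics

variable {ι : Type*} {l : Filter ι}

lemma exists_tendsto_zero_of_eventually_exists {p : ι → ℝ → ℝ → Prop} {a b : ι → ℝ}
    (ha : Tendsto a l (𝓝 0)) (hb : Tendsto b l (𝓝 0))
    (h : ∀ᶠ i in l, ∃ x y, |x| ≤ a i ∧ |y| ≤ b i ∧ p i x y) :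
    ∃ u v : ι → ℝ, Tendsto u l (𝓝 0) ∧ Tendsto v l (𝓝 0) ∧ ∀ᶠ i in l, p i (u i) (v i) := by
  have h' : ∀ i, ∃ xy : ℝ × ℝ, (∃ x y, |x| ≤ a i ∧ |y| ≤ b i ∧ p i x y) →
      |xy.1| ≤ a i ∧ |xy.2| ≤ b i ∧ p i xy.1 xy.2 := fun i => by
    by_cases hi : ∃ x y, |x| ≤ a i ∧ |y| ≤ b i ∧ p i x y
    · obtain ⟨x, y, hxy⟩ := hi
      exact ⟨(x, y), fun _ => hxy⟩
    · exact ⟨0, fun hi' => absurd hi' hi⟩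
  choose w hw using h'
  exact ⟨fun i => (w i).1, fun i => (w i).2,
    squeeze_zero_norm' (h.mono fun i hi => (hw i hi).1) ha,
    squeeze_zero_norm' (h.mono fun i hi => (hw i hi).2.1) hb, h.mono fun i hi => (hw i hi).2.2⟩

/-- Asymptotics of a signal-to-noise ratio `|e| / √V` from estimates on the mean `e` and the
variance `V` in terms of `μ`, `s` and `c`, where `n` stands for `log N`. -/
lemma snr_asymptotics {μ s c B n e V : ι → ℝ} {C : ℝ} (hC : 0 < C)
    (hη : Tendsto (fun i => √(n i) / B i) l (𝓝 0)) (hs : ∀ᶠ i in l, 0 < s i)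
    (hB : ∀ᶠ i in l, 0 < B i) (hn : ∀ᶠ i in l, 1 ≤ n i)
    (h1 : Tendsto (fun i => |c i| / √(s i) * (√(n i) / B i)) l (𝓝 0))
    (h2 : Tendsto (fun i => |μ i| / √(s i) * (√(n i) / B i) ^ (1 / 2 : ℝ)) l (𝓝 0))
    (he : ∀ᶠ i in l, ∃ x y, 0 ≤ x ∧ x ≤ C * (√(n i) / B i) ∧ |y| ≤ C * √(n i) ∧
      e i = μ i * (1 - x) + c i / B i * y)
    (hV : ∀ᶠ i in l, ∃ x y, 0 ≤ x ∧ x ≤ C * (√(n i) / B i) ∧ 0 ≤ y ∧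
      y ≤ C * (μ i ^ 2 * (√(n i) / B i) + (c i / B i) ^ 2 * n i) ∧
      V i = (s i - (c i / B i) ^ 2) * (1 - x) + y) :
    (∀ᶠ i in l, 0 < V i) ∧ ∃ u v : ι → ℝ, Tendsto u l (𝓝 0) ∧ Tendsto v l (𝓝 0) ∧
      ∀ᶠ i in l, |e i| / √(V i) = |μ i| / √(s i) * (1 + u i) + v i := by
  set η : ι → ℝ := fun i => √(n i) / B i with hηd
  -- Here `c` is the covariance itself. Multiplied by `s`, the squares of `X` and `Y` are exactly
  -- the error terms (c/B)² n and μ² η of the variance.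
  set X : ι → ℝ := fun i => |c i| / √(s i) * η i with hX
  set Y : ι → ℝ := fun i => |μ i| / √(s i) * η i ^ (1 / 2 : ℝ) with hY
  have hCη : Tendsto (fun i => C * η i) l (𝓝 0) := by simpa using hη.const_mul C
  have hCη1 : ∀ᶠ i in l, C * η i ≤ 1 := hCη.eventually_le_const one_pos
  have hX2 : ∀ᶠ i in l, X i ^ 2 * s i = (c i / B i) ^ 2 * n i := by
    filter_upwards [hs, hB, hn] with i hs hB hn
    have e1 : √(s i) ^ 2 = s i := Real.sq_sqrt hs.le
    have e2 : √(n i) ^ 2 = n i := Real.sq_sqrt (by linarith)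
    simp only [hX, hηd, mul_pow, div_pow, sq_abs, e1, e2]
    field_simp
  have hY2 : ∀ᶠ i in l, Y i ^ 2 * s i = μ i ^ 2 * η i := by
    filter_upwards [hs, hB, hn] with i hs hB hn
    have e1 : √(s i) ^ 2 = s i := Real.sq_sqrt hs.le
    have hη0 : 0 ≤ η i := by simp only [hηd]; positivity
    have e2 : (η i ^ (1 / 2 : ℝ)) ^ 2 = η i := by
      rw [← Real.sqrt_eq_rpow, Real.sq_sqrt hη0]
    simp only [hY, mul_pow, div_pow, sq_abs, e1, e2]
    field_simp
  -- the normalized variance tends to one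
  set W : ι → ℝ := fun i => V i / s i with hW
  have hW1 : Tendsto W l (𝓝 1) := by
    have hb : Tendsto (fun i => X i ^ 2 + C * η i + C * (Y i ^ 2 + X i ^ 2)) l (𝓝 0) := by
      simpa using ((h1.pow 2).add hCη).add (((h2.pow 2).add (h1.pow 2)).const_mul C)
    rw [tendsto_iff_norm_sub_tendsto_zero]
    refine squeeze_zero' (Eventually.of_forall fun i => norm_nonneg _) ?_ hb
    filter_upwards [hs, hB, hn, hX2, hY2, hV, hCη1] with i hs hB hn hX2 hY2 hV hCη1
    obtain ⟨x, y, hx0, hx, hy0, hy, hVi⟩ := hV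
    rw [← hX2, ← hY2] at hy
    have hcX : (c i / B i) ^ 2 ≤ X i ^ 2 * s i := by
      rw [hX2]; exact le_mul_of_one_le_right (sq_nonneg _) hn
    have e1 : W i - 1 = (V i - s i) / s i := by simp only [hW]; field_simp
    rw [e1, Real.norm_eq_abs, abs_div, abs_of_pos hs, div_le_iff₀ hs, hVi, abs_le]
    have hx1 : x ≤ 1 := hx.trans hCη1
    have p1 : 0 ≤ (c i / B i) ^ 2 * (1 - x) := mul_nonneg (sq_nonneg _) (by linarith)
    have p2 : 0 ≤ (c i / B i) ^ 2 * x := mul_nonneg (sq_nonneg _) hx0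
    have p3 : s i * x ≤ s i * (C * η i) := mul_le_mul_of_nonneg_left hx hs.le
    have p4 : 0 ≤ s i * x := mul_nonneg hs.le hx0
    have p5 : 0 ≤ X i ^ 2 * s i := by positivity
    have p6 : 0 ≤ C * (Y i ^ 2 * s i + X i ^ 2 * s i) := by positivity
    constructor <;> nlinarith
  have hWpos : ∀ᶠ i in l, 0 < W i := hW1.eventually_const_lt one_pos
  have hVpos : ∀ᶠ i in l, 0 < V i := by
    filter_upwards [hs, hWpos] with i hs hW
    exact (div_pos_iff_of_pos_right hs).1 hW
  refine ⟨hVpos, ?_⟩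
  have hsq : Tendsto (fun i => √(W i)) l (𝓝 1) := by simpa using hW1.sqrt
  refine exists_tendsto_zero_of_eventually_exists
    (a := fun i => (|√(W i) - 1| + C * η i) / √(W i)) (b := fun i => C * X i / √(W i))
    (p := fun i x y => |e i| / √(V i) = |μ i| / √(s i) * (1 + x) + y) ?_ ?_ ?_
  · simpa [Pi.div_def] using ((hsq.sub_const 1).abs.add hCη).div hsq one_ne_zero
  · simpa [Pi.div_def] using (h1.const_mul C).div hsq one_ne_zero
  · filter_upwards [hs, hB, hn, he, hCη1, hWpos, hVpos] with i hs hB hn he hCη1 hW0 hV0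
    obtain ⟨x, y, hx0, hx, hy, hei⟩ := he
    have hr : 0 < √(W i) := Real.sqrt_pos.2 hW0
    have hσ : 0 < √(s i) := Real.sqrt_pos.2 hs
    have hVr : √(V i) = √(s i) * √(W i) := by
      rw [← Real.sqrt_mul hs.le]; congr 1; simp only [hW]; field_simp
    have hx1 : x ≤ 1 := hx.trans hCη1
    -- The first witness makes the main term |μ (1 - x)| / √V exact; the second is the remainder,
    -- bounded through the reverse triangle inequality by the covariance term.
    refine ⟨(1 - x) / √(W i) - 1,
      |e i| / √(V i) - |μ i| / √(s i) * (1 + ((1 - x) / √(W i) - 1)), ?_, ?_, by ring⟩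
    · have e1 : (1 - x) / √(W i) - 1 = (-(√(W i) - 1) - x) / √(W i) := by field_simp; ring
      rw [e1, abs_div, abs_of_pos hr]
      gcongr
      refine (abs_sub _ _).trans ?_
      rw [abs_neg, abs_of_nonneg hx0]
      gcongr
    · have e1 : |e i| / √(V i) - |μ i| / √(s i) * (1 + ((1 - x) / √(W i) - 1)) =
          (|e i| - |μ i * (1 - x)|) / (√(s i) * √(W i)) := by
        rw [hVr, abs_mul, abs_of_nonneg (sub_nonneg.2 hx1)]
        field_simp
        ring
      have e2 : |(|e i| - |μ i * (1 - x)|)| ≤ |c i| / B i * (C * √(n i)) := by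
        refine (abs_abs_sub_abs_le_abs_sub _ _).trans ?_
        rw [hei, add_sub_cancel_left, abs_mul, abs_div, abs_of_pos hB]
        gcongr
      rw [e1, abs_div, abs_of_pos (mul_pos hσ hr), ← div_div]
      have e3 : C * X i = |c i| / B i * (C * √(n i)) / √(s i) := by
        simp only [hX, hηd]
        field_simp
      rw [e3]
      gcongr

end Asymptotics

-- Estimates uniform in the model, and the conclusion.

universe w

/-- Non-asymptotic estimates of the mean and of the variance of the doubly-reparameterized
gradient estimator with `N` samples. -/
theorem LatentModel.exists_drep_estimates {α : ℝ} (h0 : 0 ≤ α) (h1 : α < 1) :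
    ∃ C : ℝ, 0 < C ∧ ∀ {E : Type w} [MeasurableSpace E] {d : ℕ} {𝓜 : LatentModel E d}
      (_ : 𝓜.Standing) (_ : 𝓜.GaussianField) {θ : Fin 𝓜.a → ℝ} (_ : θ ∈ 𝓜.Θ) {φ : Fin 𝓜.b → ℝ}
      (_ : φ ∈ 𝓜.Φ) (k : Fin 𝓜.b) {N : ℕ} (_ : 3 ≤ N) (_ : 0 < 𝓜.B θ φ φ),
      MemLp (𝓜.drep α k θ φ N) 2 (𝓜.sampleLaw N) ∧
      (∃ x y, 0 ≤ x ∧ x ≤ C * (√(Real.log N) / 𝓜.B θ φ φ) ∧ |y| ≤ C * √(Real.log N) ∧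
        ∫ ε, 𝓜.drep α k θ φ N ε ∂𝓜.sampleLaw N = (∫ ε, 𝓜.dlogW k θ φ φ ε ∂𝓜.noise) * (1 - x) +
          cov[𝓜.logW θ φ φ, 𝓜.dlogW k θ φ φ; 𝓜.noise] / 𝓜.B θ φ φ * y) ∧
      (∃ x y, 0 ≤ x ∧ x ≤ C * (√(Real.log N) / 𝓜.B θ φ φ) ∧ 0 ≤ y ∧
        y ≤ C * ((∫ ε, 𝓜.dlogW k θ φ φ ε ∂𝓜.noise) ^ 2 * (√(Real.log N) / 𝓜.B θ φ φ) +
          (cov[𝓜.logW θ φ φ, 𝓜.dlogW k θ φ φ; 𝓜.noise] / 𝓜.B θ φ φ) ^ 2 * Real.log N) ∧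
        Var[𝓜.drep α k θ φ N; 𝓜.sampleLaw N] = (Var[𝓜.dlogW k θ φ φ; 𝓜.noise] -
          (cov[𝓜.logW θ φ φ, 𝓜.dlogW k θ φ φ; 𝓜.noise] / 𝓜.B θ φ φ) ^ 2) * (1 - x) + y) := by
  obtain ⟨K, hK, hbound⟩ := exists_integral_softmax_mul_sq_le
  have hα : 0 < 1 - α := by linarith
  have hK' : 0 < √K := Real.sqrt_pos.2 hK
  set A := √K / (1 - α) with hA
  have hA0 : 0 < A := by positivity
  -- One constant dominating `A`, `3 * A` and `2 * A` (rates in η), `√K` (mean error) and `2 * K`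
  -- (variance error).
  refine ⟨3 * A + √K + 2 * K, by positivity, ?_⟩
  intro E _ d 𝓜 h hG θ hθ φ hφ k N hN hB
  have hae := h.drep_ae_eq_drepSum hθ hφ k α N
  have hlogpos : 0 < Real.log N := Real.log_pos (by exact_mod_cast (by omega : 1 < N))
  set n := Real.log N
  set B := 𝓜.B θ φ φ with hBd
  have hL2 : (√K * √n) ^ 2 = K * n := by
    rw [mul_pow, Real.sq_sqrt hK.le, Real.sq_sqrt hlogpos.le]
  have hη0 : 0 < √n / B := by positivity
  have hLB : √K * √n / ((1 - α) * B) = A * (√n / B) := by rw [hA]; field_simp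
  obtain ⟨H1, ⟨x, y, hx0, hx, hy, hE⟩, x', y', hx0', hx', hy0', hy', hV⟩ :=
    drepSum_estimates (h.hasGaussianLaw_logW_dlogW hG hθ hφ k).1 h0 h1 (by omega : 0 < N) hB
      (L := √K * √n) (by positivity) (by rw [hL2]; exact hbound N _ hN)
  change x ≤ √K * √n / ((1 - α) * B) at hx
  change x' ≤ 3 * (√K * √n / ((1 - α) * B)) at hx'
  change y' ≤ 2 * _ * (√K * √n / ((1 - α) * B)) + _ at hy'
  rw [hLB] at hx hx' hy'
  refine ⟨H1.ae_eq hae.symm, ⟨x, y, hx0, hx.trans ?_, hy.trans ?_, ?_⟩,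
    x', y', hx0', hx'.trans ?_, hy0', hy'.trans ?_, ?_⟩
  · gcongr; linarith
  · gcongr; linarith
  · rw [integral_congr_ae hae]; exact hE
  · rw [← mul_assoc]; gcongr; linarith
  · rw [hL2, mul_add]
    have e1 : 0 ≤ (∫ ε, 𝓜.dlogW k θ φ φ ε ∂𝓜.noise) ^ 2 * (√n / B) := by positivity
    have e2 : 0 ≤ (cov[𝓜.logW θ φ φ, 𝓜.dlogW k θ φ φ; 𝓜.noise] / B) ^ 2 * n := by positivity
    refine add_le_add ?_ ?_
    · calc 2 * (∫ ε, 𝓜.dlogW k θ φ φ ε ∂𝓜.noise) ^ 2 * (A * (√n / B))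
          = (2 * A) * ((∫ ε, 𝓜.dlogW k θ φ φ ε ∂𝓜.noise) ^ 2 * (√n / B)) := by ring
        _ ≤ _ := by gcongr; linarith
    · calc 2 * (cov[𝓜.logW θ φ φ, 𝓜.dlogW k θ φ φ; 𝓜.noise] / B) ^ 2 * (K * n)
          = (2 * K) * ((cov[𝓜.logW θ φ φ, 𝓜.dlogW k θ φ φ; 𝓜.noise] / B) ^ 2 * n) := by ring
        _ ≤ _ := by gcongr; linarith
  · rw [variance_congr hae]; exact hV

lemma covariance_eq_zero_of_variance_right_eq_zero {Ω : Type*} [MeasurableSpace Ω] {P : Measure Ω}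
    [IsProbabilityMeasure P] {X D : Ω → ℝ} (hD : MemLp D 2 P) (h : Var[D; P] = 0) :
    cov[X, D; P] = 0 := by
  have := ae_eq_integral_of_variance_eq_zero hD h
  rw [covariance]
  refine integral_eq_zero_of_ae ?_
  filter_upwards [this] with ω hω
  simp [hω]

end

theorem theorem5
    {E : ℕ → Type*} [∀ d, MeasurableSpace (E d)]
    (𝓜 : ∀ d, LatentModel (E d) d)
    (h𝓜 : ∀ d, (𝓜 d).Standing)
    (α : ℝ) (hα0 : 0 ≤ α) (hα1 : α < 1)
    (θ : ∀ d, Fin (𝓜 d).a → ℝ) (hθ : ∀ d, θ d ∈ (𝓜 d).Θ)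
    (φ : ∀ d, Fin (𝓜 d).b → ℝ) (hφ : ∀ d, φ d ∈ (𝓜 d).Φ)
    (k : ∀ d, Fin (𝓜 d).b)
    (hGauss : ∀ d, (𝓜 d).GaussianField)
    (hDom : ∀ d, (𝓜 d).Dominated (k d))
    -- the asymptotic regime: `N` and `d` tend to infinity along an arbitrary filter `l`
    {ι : Type*} (l : Filter ι) (N d : ι → ℕ)
    (hN : Tendsto N l atTop) (hd : Tendsto d l atTop)
    -- `√(log N) ≪ B_d ≪ N ^ r` for some `r > 0`
    (hB : (fun i => √(Real.log (N i))) =o[l]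
      fun i => (𝓜 (d i)).B (θ (d i)) (φ (d i)) (φ (d i)))
    (hBr : ∃ r : ℝ, 0 < r ∧
      (fun i => (𝓜 (d i)).B (θ (d i)) (φ (d i)) (φ (d i))) =o[l] fun i => (N i : ℝ) ^ r) :
    -- (i)
    ((∀ᶠ i in l, 0 < Var[(𝓜 (d i)).drep α (k (d i)) (θ (d i)) (φ (d i)) 1;
        (𝓜 (d i)).sampleLaw 1]) →
      Tendsto (fun i =>
        SNR (fun ε => (𝓜 (d i)).drep α (k (d i)) (θ (d i)) (φ (d i)) 1 ε -
            (𝓜 (d i)).dlogMeanW (k (d i)) (θ (d i)) (φ (d i))) ((𝓜 (d i)).sampleLaw 1) *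
          (√(Real.log (N i)) / (𝓜 (d i)).B (θ (d i)) (φ (d i)) (φ (d i)))) l (𝓝 0) →
      Tendsto (fun i =>
        SNR ((𝓜 (d i)).drep α (k (d i)) (θ (d i)) (φ (d i)) 1) ((𝓜 (d i)).sampleLaw 1) *
          (√(Real.log (N i)) /
            (𝓜 (d i)).B (θ (d i)) (φ (d i)) (φ (d i))) ^ (1 / 2 : ℝ)) l (𝓝 0) →
      (∀ᶠ i in l,
        MemLp ((𝓜 (d i)).drep α (k (d i)) (θ (d i)) (φ (d i)) (N i)) 2
          ((𝓜 (d i)).sampleLaw (N i)) ∧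
        0 < Var[(𝓜 (d i)).drep α (k (d i)) (θ (d i)) (φ (d i)) (N i);
          (𝓜 (d i)).sampleLaw (N i)]) ∧
      ∃ u v : ι → ℝ, Tendsto u l (𝓝 0) ∧ Tendsto v l (𝓝 0) ∧ ∀ᶠ i in l,
        SNR ((𝓜 (d i)).drep α (k (d i)) (θ (d i)) (φ (d i)) (N i))
            ((𝓜 (d i)).sampleLaw (N i)) =
          SNR ((𝓜 (d i)).drep α (k (d i)) (θ (d i)) (φ (d i)) 1)
            ((𝓜 (d i)).sampleLaw 1) * (1 + u i) + v i) ∧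
    -- (ii)
    ((∀ᶠ i in l, Var[(𝓜 (d i)).drep α (k (d i)) (θ (d i)) (φ (d i)) 1;
        (𝓜 (d i)).sampleLaw 1] = 0) →
      (∀ᶠ i in l,
        MemLp ((𝓜 (d i)).drep α (k (d i)) (θ (d i)) (φ (d i)) (N i)) 2
          ((𝓜 (d i)).sampleLaw (N i))) ∧
      (∃ u : ι → ℝ, Tendsto u l (𝓝 0) ∧ ∀ᶠ i in l,
        ∫ ε, (𝓜 (d i)).drep α (k (d i)) (θ (d i)) (φ (d i)) (N i) ε
            ∂(𝓜 (d i)).sampleLaw (N i) =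
          (∫ ε, (𝓜 (d i)).drep α (k (d i)) (θ (d i)) (φ (d i)) 1 ε
            ∂(𝓜 (d i)).sampleLaw 1) * (1 + u i)) ∧
      (∃ v : ι → ℝ,
        v =O[l] (fun i =>
          √(Real.log (N i)) / (𝓜 (d i)).B (θ (d i)) (φ (d i)) (φ (d i))) ∧
        ∀ᶠ i in l,
          Var[(𝓜 (d i)).drep α (k (d i)) (θ (d i)) (φ (d i)) (N i);
              (𝓜 (d i)).sampleLaw (N i)] =
            (∫ ε, (𝓜 (d i)).drep α (k (d i)) (θ (d i)) (φ (d i)) 1 ε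
              ∂(𝓜 (d i)).sampleLaw 1) ^ 2 * v i)) := by

  obtain ⟨C, hC, hest⟩ := LatentModel.exists_drep_estimates hα0 hα1
  set B : ι → ℝ := fun i => (𝓜 (d i)).B (θ (d i)) (φ (d i)) (φ (d i))
  set μ : ι → ℝ := fun i =>
    ∫ ε, (𝓜 (d i)).dlogW (k (d i)) (θ (d i)) (φ (d i)) (φ (d i)) ε ∂(𝓜 (d i)).noise
  set s : ι → ℝ := fun i =>
    Var[(𝓜 (d i)).dlogW (k (d i)) (θ (d i)) (φ (d i)) (φ (d i)); (𝓜 (d i)).noise]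
  set c : ι → ℝ := fun i => cov[(𝓜 (d i)).logW (θ (d i)) (φ (d i)) (φ (d i)),
    (𝓜 (d i)).dlogW (k (d i)) (θ (d i)) (φ (d i)) (φ (d i)); (𝓜 (d i)).noise]
  have hη : Tendsto (fun i => √(Real.log (N i)) / B i) l (𝓝 0) := hB.tendsto_div_nhds_zero
  have hN3 : ∀ᶠ i in l, 3 ≤ N i := hN.eventually_ge_atTop 3
  have hlog : ∀ᶠ i in l, 1 ≤ Real.log (N i) := by
    filter_upwards [hN3] with i hi
    have h3 : (3 : ℝ) ≤ N i := by exact_mod_cast hi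
    rw [Real.le_log_iff_exp_le (by linarith)]
    linarith [Real.exp_one_lt_d9]
  -- `B` dominates √(log N) ≥ 1, so it cannot vanish.
  have hBpos : ∀ᶠ i in l, 0 < B i := by
    filter_upwards [hB.bound one_pos, hlog] with i hi hl
    have hB0 : 0 ≤ B i := Real.sqrt_nonneg _
    refine hB0.lt_of_ne fun e => ?_
    change ‖√(Real.log (N i))‖ ≤ 1 * ‖B i‖ at hi
    rw [← e, norm_zero, mul_zero, norm_le_zero_iff, Real.sqrt_eq_zero'] at hi
    linarith
  have hest' := (hN3.and hBpos).mono fun i hi =>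
    hest (h𝓜 (d i)) (hGauss (d i)) (hθ (d i)) (hφ (d i)) (k (d i)) hi.1 hi.2
  have hE1 := fun i => (h𝓜 (d i)).integral_drep_one (hGauss (d i)) (hθ (d i)) (hφ (d i)) (k (d i)) α
  have hV1 := fun i => (h𝓜 (d i)).variance_drep_one (hGauss (d i)) (hθ (d i)) (hφ (d i)) (k (d i)) α
  have hS1 := fun i => (h𝓜 (d i)).snr_drep_one (hGauss (d i)) (hθ (d i)) (hφ (d i)) (k (d i)) α
  have hS2 := fun i => (h𝓜 (d i)).snr_drep_one_sub_dlogMeanW (hGauss (d i)) (hθ (d i)) (hφ (d i))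
    (k (d i)) α
  simp only [hE1, hV1, hS1, hS2]
  refine ⟨fun hvar h1 h2 => ?_, fun hvar => ?_⟩
  · obtain ⟨hVpos, hsnr⟩ := snr_asymptotics hC hη hvar hBpos hlog h1 h2
      (hest'.mono fun i hi => hi.2.1) (hest'.mono fun i hi => hi.2.2)
    exact ⟨(hest'.and hVpos).mono fun i hi => ⟨hi.1.1, hi.2⟩, hsnr⟩
  · have hc0 : ∀ᶠ i in l, c i = 0 := by
      filter_upwards [hvar] with i hi
      have := (h𝓜 (d i)).isProbabilityMeasure_noise
      exact covariance_eq_zero_of_variance_right_eq_zero ((h𝓜 (d i)).hasGaussianLaw_logW_dlogW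
        (hGauss (d i)) (hθ (d i)) (hφ (d i)) (k (d i))).1.snd.memLp_two hi
    refine ⟨hest'.mono fun i hi => hi.1, ?_, ?_⟩
    · obtain ⟨u, -, hu, -, h⟩ := exists_tendsto_zero_of_eventually_exists (l := l)
        (a := fun i => C * (√(Real.log (N i)) / B i)) (b := fun _ => 0)
        (p := fun i x _ => ∫ ε, (𝓜 (d i)).drep α (k (d i)) (θ (d i)) (φ (d i)) (N i) ε
            ∂(𝓜 (d i)).sampleLaw (N i) = μ i * (1 + x))
        (by simpa using hη.const_mul C) tendsto_const_nhds (by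
          filter_upwards [hest', hc0] with i hi hc0
          obtain ⟨-, ⟨x, y, hx0, hx, -, hE⟩, -⟩ := hi
          refine ⟨-x, 0, ?_, by simp, ?_⟩
          · rwa [abs_neg, abs_of_nonneg hx0]
          · change _ = μ i * (1 - x) + c i / B i * y at hE
            rw [hE, hc0]; ring)
      exact ⟨u, hu, h⟩
    · have hle : ∀ᶠ i in l, Var[(𝓜 (d i)).drep α (k (d i)) (θ (d i)) (φ (d i)) (N i);
          (𝓜 (d i)).sampleLaw (N i)] ≤ μ i ^ 2 * (C * (√(Real.log (N i)) / B i)) := by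
        filter_upwards [hest', hc0, hvar] with i hi hc0 hv
        obtain ⟨-, -, x, y, hx0, hx, hy0, hy, hV⟩ := hi
        change y ≤ C * (μ i ^ 2 * (√(Real.log (N i)) / B i) + (c i / B i) ^ 2 * _) at hy
        change _ = (_ - (c i / B i) ^ 2) * (1 - x) + y at hV
        rw [hV, hv, hc0]
        rw [hc0] at hy
        simp only [zero_div, ne_eq, OfNat.ofNat_ne_zero, not_false_eq_true, zero_pow, sub_zero,
          zero_mul, add_zero, zero_add] at hy ⊢
        linarith
      -- If μ = 0 the quotient is 0 by convention, and `hle` forces the variance to vanish too, so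
      -- the identity survives.
      refine ⟨fun i => Var[(𝓜 (d i)).drep α (k (d i)) (θ (d i)) (φ (d i)) (N i);
          (𝓜 (d i)).sampleLaw (N i)] / μ i ^ 2, ?_, ?_⟩
      · refine IsBigO.of_bound C ?_
        filter_upwards [hle, hBpos] with i hi hb
        rw [Real.norm_of_nonneg (div_nonneg (variance_nonneg _ _) (sq_nonneg _)),
          Real.norm_of_nonneg (div_nonneg (Real.sqrt_nonneg _) hb.le)]
        exact div_le_of_le_mul₀ (sq_nonneg _)
          (mul_nonneg hC.le (div_nonneg (Real.sqrt_nonneg _) hb.le)) (by linarith)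
      · filter_upwards [hle] with i hi
        rcases eq_or_ne (μ i) 0 with h0 | h0
        · rw [h0, zero_pow two_ne_zero, zero_mul] at hi
          have := le_antisymm hi (variance_nonneg _ _)
          change _ = μ i ^ 2 * _
          rw [this, h0]; simp
        · change _ = μ i ^ 2 * _
          field_simp
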